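/- Let $\mathcal A$ be a finite alphabet and $\eta\colon\mathbb Z^2\to\mathcal A$. For $S\subseteq\mathbb Z^2$, an $\eta$-coloring of $S$ is a function of the form $x\mapsto\eta(x+u)$ on $S$, for some $u\in\mathbb Z^2$; for finite $S$ let $P_\eta(S)$ be the number of $\eta$-colorings of $S$, and for finite nonempty $S$ let $D_\eta(S)=P_\eta(S)-|S|$. Let $X_S(\eta)$ be the set of all $f\colon\mathbb Z^2\to\mathcal A$ such that every $f$-coloring of $S$ is an $\eta$-coloring of $S$. A point $x\in S$ is $\eta$-generated by $S$ if every $\eta$-coloring of $S\setminus\{x\}$ extends uniquely to an $\eta$-coloring of $S$. A set $S\subseteq\mathbb Z^2$ is convex if its convex hull in $\mathbb R^2$ is closed and contains no integer points outside $S$. An oriented rational line $\ell$ through the origin is given by the shortest nonzero integer vector $v$ in its direction. It is one-sided $\eta$-expansive if there are $a,b\in\mathbb N$ and $M\in SL_2(\mathbb Z)$ with $M(0,-1)=v$ such that every $(\eta\circ M)$-coloring of $([0,a]\times[-b,b])\cap\mathbb Z^2$ extends uniquely to an $(\eta\circ M)$-coloring of $(([0,a]\times[-b,b])\cap\mathbb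 Z^2)\cup\{(-1,0)\}$; otherwise it is one-sided nonexpansive. An $\ell$-half plane is a set $\{z\in\mathbb Z^2:\det(v,z)\ge c\}$ with $c\in\mathbb Z$. An $\ell$-strip of width $m\geq 1$ is the set of integer points on $m$ consecutive lines $\{z:\det(v,z)=c\}$, $c\in\mathbb Z$. For a finite nonempty set $S\subset\mathbb Z^2$ let $\ell(S)$ be the set of points of $S$ at which $\det(v,\cdot)$ attains its minimum over $S$, and let $\operatorname{diam}_\ell(S)$ be the number of distinct lines parallel to $\ell$ that meet $S$. A finite convex set $S$ is $\ell$-balanced for $\eta$ if $S\setminus\ell(S)\ne\emptyset$; every line parallel to $\ell$ that meets $S$ contains at least $|\ell(S)|-1$ points of $S$; the endpoints of $\ell(S)$ are $\eta$-generated by $S$; and $D_\eta(S\setminus\ell(S))>D_\eta(S)$. For an $\ell$-half plane $H$ and $f\in X_S(\eta)$, the restriction $f|_H$ is $(S,\eta)$-ambiguous if there are $g_1,g_2\in X_S(\eta)$ that agree with $f$ on $H$ but differ from each other somewhere on the smallest $\ell$-half plane strictly containing $H$. For a finite set $T$, the $T$-border of $H$ is the union of all integer translates $T+u\subseteq H$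 such that $\ell(T)+u$ lies on the boundary line of $H$. The restriction of $f$ to a set $B$ has period at most $N$ if there is an integer $1\le p\le N$ such that $B+pv\subseteq B$ and $f(x+pv)=f(x)$ for all $x\in B$. **Proposition.** Suppose there are $n,k\in\mathbb N$ such that the rectangle $R_{n,k}=\{(x,y)\in\mathbb Z^2:0\le x<n,\ 0\le y<k\}$ satisfies $P_\eta(R_{n,k})\le\frac{nk}{2}$. Let $\ell$ be a one-sided nonexpansive direction for $\eta$ and let $H$ be an $\ell$-half plane. Then there is an $\ell$-balanced set $S$ that has an edge $w$ parallel to $\ell$, that is, $w\cap S=\ell(S)$ has at least two points, such that for every $f\in X_S(\eta)$ whose restriction to $H$ is $(S,\eta)$-ambiguous: 1. $f$ is periodic with a nonzero period vector parallel to $\ell$; 2. the restriction of $f$ to the $(S\setminus w)$-border of $H$ has period at most $|w\cap S|-1$, and the restriction of $f$ to every $\ell$-strip of width $\operatorname{diam}_\ell(S\setminus w)$ has period at most $2|w\cap S|-2$. -/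

import Mathlib

namespace Nivat

variable {A : Type*}

/-! ### Colorings, complexity and discrepancy -/

/-- The set `𝒲(S, η)` of `η`-colorings of `S`: all restrictions to `S` of the translates
`(T^u η)(x) = η (x + u)`. -/
def words (η : ℤ × ℤ → A) (S : Set (ℤ × ℤ)) : Set (S → A) :=
  Set.range fun (u : ℤ × ℤ) (x : S) => η (x + u)

/-- The complexity `P_η(S)`: the number of `η`-colorings of `S` (used for finite `S`). -/
noncomputable def complexity (η : ℤ × ℤ → A) (S : Set (ℤ × ℤ)) : ℕ :=
  (words η S).ncard

/-- The discrepancy `D_η(S) = P_η(S) - |S|` (used for finite nonempty `S`). -/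
noncomputable def discrepancy (η : ℤ × ℤ → A) (S : Set (ℤ × ℤ)) : ℤ :=
  (complexity η S : ℤ) - (S.ncard : ℤ)

/-- The rectangle `R_{n,k}` of integer points. -/
def rect (n k : ℕ) : Set (ℤ × ℤ) :=
  {z | 0 ≤ z.1 ∧ z.1 < n ∧ 0 ≤ z.2 ∧ z.2 < k}

/-- The coloring `α` of `T` extends uniquely to an `η`-coloring of `S ⊇ T`. -/
def ExtendsUniquely (η : ℤ × ℤ → A) {T S : Set (ℤ × ℤ)} (h : T ⊆ S) (α : T → A) : Prop :=
  ∃! β : S → A, β ∈ words η S ∧ ∀ t : T, β ⟨t, h t.2⟩ = α t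

/-- The point `x` is `η`-generated by `S`: every `η`-coloring of `S \ {x}` extends uniquely to an
`η`-coloring of `S`. -/
def IsGenerated (η : ℤ × ℤ → A) (S : Set (ℤ × ℤ)) (x : ℤ × ℤ) : Prop :=
  ∀ α ∈ words η (S \ {x}), ExtendsUniquely η (Set.sdiff_subset : S \ {x} ⊆ S) α

/-- The subshift of finite type `X_S(η)` generated by the `S`-words of `η`. -/
def sft (η : ℤ × ℤ → A) (S : Set (ℤ × ℤ)) : Set (ℤ × ℤ → A) :=
  {f | words f S ⊆ words η S}

/-! ### Lattice geometry

An oriented rational line through the origin is represented by the shortest nonzero integer vector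
`v` pointing in its direction, that is, by a vector `v` with coprime coordinates.  The integer
points on the lines parallel to `v` are the level sets of `z ↦ cross v z`; for such `v` this map is
onto `ℤ`.  The points with larger value of `cross v` lie to the left of those with smaller value,
when looking in the direction of `v`. -/

/-- The determinant `det (v, z)`. -/
def cross (v z : ℤ × ℤ) : ℤ := v.1 * z.2 - v.2 * z.1

/-- The inclusion of `ℤ²` in `ℝ²`. -/
def toReal (z : ℤ × ℤ) : ℝ × ℝ := ((z.1 : ℝ), (z.2 : ℝ))

/-- A convex subset of `ℤ²`: its convex hull in `ℝ²` is closed and contains no integer points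
outside the set. -/
def IsLatticeConvex (S : Set (ℤ × ℤ)) : Prop :=
  IsClosed (convexHull ℝ (toReal '' S)) ∧ ∀ z, toReal z ∈ convexHull ℝ (toReal '' S) → z ∈ S

/-- The integer points of `S` on the support line `ℓ(v, S)`, the boundary of the smallest half plane
that contains `S` and whose positively (counterclockwise) oriented boundary is parallel to `v`. -/
def face (v : ℤ × ℤ) (S : Set (ℤ × ℤ)) : Set (ℤ × ℤ) :=
  {z | z ∈ S ∧ ∀ s ∈ S, cross v z ≤ cross v s}

/-- `x` is an endpoint of a set `F` of integer points on a line parallel to `v`: all points of `F`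
lie on the same side of `x`. -/
def IsEndpoint (v : ℤ × ℤ) (F : Set (ℤ × ℤ)) (x : ℤ × ℤ) : Prop :=
  x ∈ F ∧ ((∀ y ∈ F, ∃ i : ℕ, y = x + (i : ℤ) • v) ∨ (∀ y ∈ F, ∃ i : ℕ, y = x - (i : ℤ) • v))

/-- The number of distinct lines parallel to `v` that meet `S`. -/
noncomputable def diam (v : ℤ × ℤ) (S : Set (ℤ × ℤ)) : ℕ := (cross v '' S).ncard

/-- `H` is a `v`-half plane: its positively (counterclockwise) oriented boundary is a line parallel
to `v`, so that `H` lies to the left of this line, which it contains. -/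
def IsHalfPlane (v : ℤ × ℤ) (H : Set (ℤ × ℤ)) : Prop :=
  ∃ c : ℤ, H = {z | c ≤ cross v z}

/-- The extension of a `v`-half plane `H` over its boundary: the smallest `v`-half plane strictly
containing `H`. -/
def halfPlaneExt (v : ℤ × ℤ) (H : Set (ℤ × ℤ)) : Set (ℤ × ℤ) :=
  ⋂₀ {K | IsHalfPlane v K ∧ H ⊂ K}

/-- `B` is a `v`-strip: the integer points between two parallels to `v`, or on one such line
(the case `a = b`).  Its width is `diam v B`. -/
def IsStrip (v : ℤ × ℤ) (B : Set (ℤ × ℤ)) : Prop :=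
  ∃ a b : ℤ, a ≤ b ∧ B = {z | a ≤ cross v z ∧ cross v z ≤ b}

/-- The `T`-border of the half plane `H` in direction `v`: the union of the translates of `T` that
lie in `H` and whose boundary part in direction `v` lies on the boundary line of `H`. -/
def border (v : ℤ × ℤ) (T H : Set (ℤ × ℤ)) : Set (ℤ × ℤ) :=
  {z | ∃ u : ℤ × ℤ, (∀ t ∈ T, t + u ∈ H) ∧ (∀ t ∈ face v T, t + u ∈ face v H) ∧
    ∃ t ∈ T, z = t + u}

/-! ### One-sided expansiveness -/

/-- The linear action of `SL₂(ℤ)` on `ℤ²`. -/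
def slAct (M : Matrix.SpecialLinearGroup (Fin 2) ℤ) (z : ℤ × ℤ) : ℤ × ℤ :=
  (M.1 0 0 * z.1 + M.1 0 1 * z.2, M.1 1 0 * z.1 + M.1 1 1 * z.2)

/-- The integer points of `[0, a] × [-b, b]`. -/
def box (a b : ℕ) : Set (ℤ × ℤ) :=
  {z | 0 ≤ z.1 ∧ z.1 ≤ a ∧ -(b : ℤ) ≤ z.2 ∧ z.2 ≤ b}

/-- The direction `v` is one-sided `η`-expansive: for some `a`, `b` and some `M ∈ SL₂(ℤ)` mapping
the downward oriented `y`-axis to the line spanned by `v`, every `(η ∘ M)`-coloring of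
`[0, a] × [-b, b]` extends uniquely to an `(η ∘ M)`-coloring of `[0, a] × [-b, b] ∪ {(-1, 0)}`. -/
def IsOneSidedExpansive (η : ℤ × ℤ → A) (v : ℤ × ℤ) : Prop :=
  ∃ (a b : ℕ) (M : Matrix.SpecialLinearGroup (Fin 2) ℤ), slAct M (0, -1) = v ∧
    ∀ α ∈ words (η ∘ slAct M) (box a b),
      ExtendsUniquely (η ∘ slAct M)
        (Set.subset_union_left : box a b ⊆ box a b ∪ {((-1, 0) : ℤ × ℤ)}) α

/-! ### Balanced sets, ambiguity and periodicity -/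

/-- `S` is balanced for `η` in the direction `v`.  The discrepancy of `S \ face v S` is only
meaningful when this set is nonempty, which is therefore part of the definition. -/
structure IsBalanced (η : ℤ × ℤ → A) (v : ℤ × ℤ) (S : Set (ℤ × ℤ)) : Prop where
  finite : S.Finite
  convex : IsLatticeConvex S
  diff_nonempty : (S \ face v S).Nonempty
  lines : ∀ t : ℤ, {z | z ∈ S ∧ cross v z = t}.Nonempty →
    (face v S).ncard ≤ {z | z ∈ S ∧ cross v z = t}.ncard + 1
  generated : ∀ x, IsEndpoint v (face v S) x → IsGenerated η S x
  discrepancy_lt : discrepancy η S < discrepancy η (S \ face v S)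

/-- The coloring `f ∈ X_S(η)` is `(S, T₁, T₂, η)`-ambiguous: two elements of `X_S(η)` agree with `f`
on `T₁` but differ from each other somewhere on `T₂`. -/
def IsAmbiguous (η : ℤ × ℤ → A) (S T₁ T₂ : Set (ℤ × ℤ)) (f : ℤ × ℤ → A) : Prop :=
  f ∈ sft η S ∧ ∃ g₁ ∈ sft η S, ∃ g₂ ∈ sft η S,
    Set.EqOn g₁ f T₁ ∧ Set.EqOn g₂ f T₁ ∧ ¬ Set.EqOn g₁ g₂ T₂

/-- The restriction of `f ∈ X_S(η)` to the `v`-half plane `H` is `(S, η)`-ambiguous. -/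
def IsHalfPlaneAmbiguous (η : ℤ × ℤ → A) (v : ℤ × ℤ) (S H : Set (ℤ × ℤ)) (f : ℤ × ℤ → A) : Prop :=
  IsAmbiguous η S H (halfPlaneExt v H) f

/-- The restriction of `f` to `T` is periodic with period vector `p`. -/
def PeriodicOn (f : ℤ × ℤ → A) (T : Set (ℤ × ℤ)) (p : ℤ × ℤ) : Prop :=
  p ≠ 0 ∧ ∀ x ∈ T, x + p ∈ T ∧ f (x + p) = f x

/-- The restriction of `f` to `T` is periodic in the direction of the primitive vector `v`, with
period at most `N`. -/
def HasPeriodAtMost (f : ℤ × ℤ → A) (T : Set (ℤ × ℤ)) (v : ℤ × ℤ) (N : ℕ) : Prop :=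
  ∃ p : ℕ, 1 ≤ p ∧ p ≤ N ∧ PeriodicOn f T ((p : ℤ) • v)

end Nivat

namespace Nivat

variable {A : Type*}

/-! Work in coordinates along `v` and along some `u` with `cross v u = 1`, so that the lines
parallel to `v` are the levels of `cross v`.

Construction of `S`. Cut the rectangle by the line parallel to `v` through its centre. By central
symmetry the lower half has at least `n * k / 2` points, hence at least as many points as colorings,
and on its lines the number of points drops by at most one as the level rises (`ncard_row_rect_le`).
Among all convex sets with these properties take one of least cardinality. Deleting an endpoint of
the bottom line, or the whole bottom line, preserves everything except possibly `complexity ≤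
cardinality`. Minimality therefore makes the endpoints generated and gives `S` fewer than `W`
colorings more than `S \ face v S`, where `W` is the number of points on the bottom line. If `W =
1`, the generated vertex would make `v` one-sided expansive. If `S` were a single line,
Morse–Hedlund would make `η` periodic along `v`; periodic `η` are treated separately with a long
parallelogram (`exists_balanced_of_periodic`).

Ambiguity gives a short period. If two elements of `X_S(η)` agree above a line but differ on it,
every word of shape `S \ face v S` read along the strip above has two extensions: otherwise they
would agree on `W` consecutive points, and the generated endpoints would carry the agreement along
the line. At most `W - 1` words fork, and their extensions number at most `2 * W - 2`
(`ncard_forkWords_le`). As every line of `S` has at least `W - 1` points, Morse–Hedlund gives a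
period at most `W - 1` on the strip, and counting the extensions gives one at most `2 * W - 2` with
the next line included.

From the strip to the plane. Since `complexity η S ≤ S.ncard`, elements of `X_S(η)` satisfy a common
affine relation, which spreads a multiple of this period to all lines (`exists_global_period`). The
bound `2 * W - 2` passes downwards line by line, either by forking or by unique extension. It passes
upwards because a strip violating it could be pushed down, along a recurrence of strips, below a
strip that satisfies it (`strips_periodic`). -/

/-! ### One-dimensional sequences: Morse–Hedlund and linear recurrences. -/

/-- A bi-infinite sequence with finite range in which every term determines its successor is
periodic, and every term determines its predecessor as well. -/
theorem periodic_of_deterministic {Z : Type*} (s : ℤ → Z) (K : ℕ) (hfin : (Set.range s).Finite)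
    (hK : (Set.range s).ncard ≤ K) (hdet : ∀ i j, s i = s j → s (i + 1) = s (j + 1)) :
    (∀ i j, s i = s j → ∀ k : ℤ, s (i + k) = s (j + k)) ∧
      ∃ q : ℕ, 1 ≤ q ∧ q ≤ K ∧ ∀ i, s (i + q) = s i := by
  -- The successor map on the finite range is well defined and surjective, hence injective.
  have hback : ∀ i j, s i = s j → s (i - 1) = s (j - 1) := by
    have : Finite (Set.range s) := hfin
    choose pre hpre using fun z : Set.range s => z.2
    let φ : Set.range s → Set.range s := fun z => ⟨s (pre z + 1), pre z + 1, rfl⟩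
    have hφ : ∀ i, φ ⟨s i, i, rfl⟩ = ⟨s (i + 1), i + 1, rfl⟩ := fun i =>
      Subtype.ext (hdet _ _ (hpre ⟨s i, i, rfl⟩))
    have hsurj : Function.Surjective φ := by
      rintro ⟨_, i, rfl⟩
      refine ⟨⟨s (i - 1), i - 1, rfl⟩, ?_⟩
      rw [hφ]; simp
    have hinj := Finite.injective_iff_surjective.2 hsurj
    intro i j hij
    have h := @hinj ⟨s (i - 1), i - 1, rfl⟩ ⟨s (j - 1), j - 1, rfl⟩ (by
      rw [hφ, hφ]; simpa using hij)
    exact congrArg Subtype.val h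
  have hall : ∀ i j, s i = s j → ∀ k : ℤ, s (i + k) = s (j + k) := by
    intro i j hij k
    induction k using Int.induction_on with
    | zero => simpa using hij
    | succ k ih => simpa [add_assoc] using hdet _ _ ih
    | pred k ih =>
      have := hback _ _ ih
      rwa [show i + (-(k : ℤ) - 1) = i + -(k : ℤ) - 1 by ring,
        show j + (-(k : ℤ) - 1) = j + -(k : ℤ) - 1 by ring]
  refine ⟨hall, ?_⟩
  have hmaps : Set.MapsTo (fun a : ℕ => s a) (Finset.range (K + 1)) hfin.toFinset := by
    intro a _; simp
  obtain ⟨a, ha, b, hb, hab, h⟩ := Finset.exists_ne_map_eq_of_card_lt_of_maps_to (by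
    rw [← Set.ncard_eq_toFinset_card _ hfin]; simpa using Nat.lt_succ_of_le hK) hmaps
  wlog hlt : a < b generalizing a b
  · exact this b hb a ha hab.symm h.symm (by omega)
  simp only [Finset.mem_range] at ha hb
  refine ⟨b - a, by omega, by omega, fun i => ?_⟩
  have := hall _ _ h (i - a)
  rw [show (a : ℤ) + (i - a) = i by ring] at this
  rw [this, Nat.cast_sub hlt.le]
  congr 1; ring

/-- A form of the Morse–Hedlund theorem: if the windows of length `n` of `y` are determined by the
terms of a sequence `κ` with at most `n` values, then `y` has a period at most `n`, and equal terms
of `κ` are surrounded by equal parts of `y`. -/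
theorem morse_hedlund {Y Z : Type*} (y : ℤ → Y) (n : ℕ) (κ : ℤ → Z) (hfin : (Set.range κ).Finite)
    (hn : (Set.range κ).ncard ≤ n)
    (hκ : ∀ i j, κ i = κ j → ∀ k : ℕ, k < n → y (i + k) = y (j + k)) :
    (∀ i j, κ i = κ j → ∀ k : ℤ, y (i + k) = y (j + k)) ∧
      ∃ p : ℕ, 1 ≤ p ∧ p ≤ n ∧ ∀ i, y (i + p) = y i := by
  let w : (m : ℕ) → ℤ → (Fin m → Y) := fun m i k => y (i + (k : ℕ))
  have hw : ∀ m i j, w m i = w m j ↔ ∀ k : ℕ, k < m → y (i + k) = y (j + k) := by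
    intro m i j
    constructor
    · intro h k hk; exact congrFun h ⟨k, hk⟩
    · intro h; funext k; exact h k k.2
  -- `w n` factors through `κ`
  have hfac : ∀ m ≤ n, (Set.range (w m)).Finite ∧ (Set.range (w m)).ncard ≤ n := by
    intro m hm
    choose pre hpre using fun z : Set.range κ => z.2
    have : Finite (Set.range κ) := hfin
    have heq : Set.range (w m) ⊆ Set.range (fun z : Set.range κ => w m (pre z)) := by
      rintro _ ⟨i, rfl⟩
      exact ⟨⟨κ i, i, rfl⟩, (hw _ _ _).2 fun k hk => hκ _ _ (hpre ⟨κ i, i, rfl⟩) k (by omega)⟩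
    have hf := Set.finite_range (fun z : Set.range κ => w m (pre z))
    refine ⟨hf.subset heq, (Set.ncard_le_ncard heq hf).trans ?_⟩
    rw [← Set.image_univ]
    refine (Set.ncard_image_le Set.finite_univ).trans ?_
    rwa [Set.ncard_univ, Nat.card_coe_set_eq]
  -- If no window length below `n` determined the next term, the number of windows would grow at
  -- each step and reach `n + 1` at length `n`.
  obtain ⟨m, hmn, hm⟩ : ∃ m < n, ∀ i j, w m i = w m j → w (m + 1) i = w (m + 1) j := by
    by_contra! hcon
    have hgrow : ∀ m ≤ n, m + 1 ≤ (Set.range (w m)).ncard := by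
      intro m
      induction m with
      | zero =>
        intro h
        exact Nat.succ_le_of_lt ((Set.ncard_pos (hfac 0 h).1).2 ⟨_, 0, rfl⟩)
      | succ m ih =>
        intro h
        obtain ⟨i, j, hij, hne⟩ := hcon m (by omega)
        have him : Set.range (w m) ⊆
            (fun (x : Fin (m + 1) → Y) (k : Fin m) => x k.castSucc) ''
              (Set.range (w (m + 1)) \ {w (m + 1) j}) := by
          rintro _ ⟨l, rfl⟩
          by_cases hl : w (m + 1) l = w (m + 1) j
          · refine ⟨w (m + 1) i, ⟨⟨i, rfl⟩, hne⟩, ?_⟩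
            have : w m l = w m j := (hw _ _ _).2 fun k hk => (hw _ _ _).1 hl k (by omega)
            rw [this, ← hij]; rfl
          · exact ⟨w (m + 1) l, ⟨⟨l, rfl⟩, hl⟩, rfl⟩
        have hf := (hfac (m + 1) h).1
        have h1 := Set.ncard_le_ncard him ((hf.subset Set.sdiff_subset).image _)
        have h2 := Set.ncard_image_le (hf.subset (Set.sdiff_subset (t := {w (m + 1) j})))
          (f := fun (x : Fin (m + 1) → Y) (k : Fin m) => x k.castSucc)
        have h3 := Set.ncard_sdiff_singleton_lt_of_mem (s := Set.range (w (m + 1)))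
          ⟨j, rfl⟩ hf
        have := ih (by omega)
        omega
    have := hgrow n le_rfl
    have := (hfac n le_rfl).2
    omega
  have hstep : ∀ i j, w m i = w m j → w m (i + 1) = w m (j + 1) := by
    intro i j hij
    have h := (hw _ _ _).1 (hm i j hij)
    refine (hw _ _ _).2 fun k hk => ?_
    have := h (k + 1) (by omega)
    rw [show i + 1 + (k : ℤ) = i + ((k + 1 : ℕ) : ℤ) by push_cast; ring,
      show j + 1 + (k : ℤ) = j + ((k + 1 : ℕ) : ℤ) by push_cast; ring, this]
  obtain ⟨h1, q, hq1, hq2, hq⟩ := periodic_of_deterministic (w m) n (hfac m hmn.le).1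
    (hfac m hmn.le).2 hstep
  -- The value `y i` is read off the window of length `m + 1`, since `m` may be `0`.
  have hy : ∀ i j, w m i = w m j → y i = y j := fun i j hij => by
    simpa using (hw _ _ _).1 (hm i j hij) 0 (by omega)
  refine ⟨fun i j hij k => hy _ _ (h1 _ _ ((hw _ _ _).2 fun k hk => hκ _ _ hij k (by omega)) k),
    q, hq1, hq2, fun i => hy _ _ (hq i)⟩

theorem apply_add_mul_of_periodic {Z : Type*} (s : ℤ → Z) {q : ℤ} (hq : ∀ i, s (i + q) = s i)
    (k i : ℤ) : s (i + k * q) = s i := by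
  induction k using Int.induction_on with
  | zero => simp
  | succ k ih => rw [show i + ((k : ℤ) + 1) * q = (i + k * q) + q by ring, hq, ih]
  | pred k ih =>
    rw [← hq, show i + (-(k : ℤ) - 1) * q + q = i + -(k : ℤ) * q by ring, ih]

/-- Sequences with values in a finite set that satisfy a given nontrivial linear recurrence have a
common period. -/
theorem exists_period_of_recurrence (I : Finset ℤ) (b : ℤ → ℚ) (hb : ∃ i ∈ I, b i ≠ 0)
    (V : Set ℚ) (hV : V.Finite) :
    ∃ N : ℕ, 1 ≤ N ∧ ∀ e : ℤ → ℚ, (∀ i, e i ∈ V) → (∀ j, ∑ i ∈ I, b i * e (i + j) = 0) →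
      ∀ i, e (i + N) = e i := by
  obtain ⟨i₀, hi₀, hbi₀⟩ := hb
  let J := I.filter fun i => b i ≠ 0
  have hJ : J.Nonempty := ⟨i₀, by simp [J, hi₀, hbi₀]⟩
  let lo := J.min' hJ
  let hi := J.max' hJ
  have hlohi : lo ≤ hi := J.min'_le _ (J.max'_mem hJ)
  let d := (hi - lo).toNat
  have hd : (d : ℤ) = hi - lo := Int.toNat_of_nonneg (by omega)
  let VV : Set (Fin d → ℚ) := {s | ∀ i, s i ∈ V}
  have hVV : VV.Finite := by
    have := Set.Finite.pi (fun _ : Fin d => hV)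
    refine this.subset fun s hs => ?_
    simpa using (show ∀ i, s i ∈ V from hs)
  -- Each sequence has a period at most the number of windows of length `d`; the factorial is a
  -- multiple of all of these.
  refine ⟨Nat.factorial VV.ncard, Nat.factorial_pos _, fun e he hrec => ?_⟩
  have hrecJ : ∀ j, ∑ i ∈ J, b i * e (i + j) = 0 := by
    intro j
    rw [← hrec j]
    refine Finset.sum_subset (Finset.filter_subset _ _) fun i hi hiJ => ?_
    have : b i = 0 := by
      by_contra h; exact hiJ (by simp [J, hi, h])
    simp [this]
  let s : ℤ → (Fin d → ℚ) := fun j k => e (j + (k : ℕ))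
  have hs : ∀ i j, s i = s j ↔ ∀ k : ℕ, k < d → e (i + k) = e (j + k) := by
    intro i j
    constructor
    · intro h k hk; exact congrFun h ⟨k, hk⟩
    · intro h; funext k; exact h k k.2
  have hrange : Set.range s ⊆ VV := by
    rintro _ ⟨i, rfl⟩ k; exact he _
  have hnext : ∀ i j, s i = s j → e (i + d) = e (j + d) := by
    intro i j hij
    have hmem : hi ∈ J := J.max'_mem hJ
    have h1 := hrecJ (i - lo)
    have h2 := hrecJ (j - lo)
    rw [← Finset.add_sum_erase _ _ hmem] at h1 h2
    have h3 : ∑ l ∈ J.erase hi, b l * e (l + (i - lo)) =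
        ∑ l ∈ J.erase hi, b l * e (l + (j - lo)) := by
      refine Finset.sum_congr rfl fun l hl => ?_
      have hl1 : lo ≤ l := J.min'_le _ (Finset.mem_of_mem_erase hl)
      have hl2 : l ≤ hi := J.le_max' _ (Finset.mem_of_mem_erase hl)
      have hl3 : l ≠ hi := Finset.ne_of_mem_erase hl
      have := (hs i j).1 hij (l - lo).toNat (by omega)
      rw [Int.toNat_of_nonneg (by omega)] at this
      rw [show l + (i - lo) = i + (l - lo) by ring, this]
      congr 2; ring
    have hbne : b hi ≠ 0 := (Finset.mem_filter.1 hmem).2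
    have : b hi * e (hi + (i - lo)) = b hi * e (hi + (j - lo)) := by linarith
    have := mul_left_cancel₀ hbne this
    rw [hd, show i + (hi - lo) = hi + (i - lo) by ring, this]
    congr 1; ring
  have hdet : ∀ i j, s i = s j → s (i + 1) = s (j + 1) := by
    intro i j hij
    refine (hs _ _).2 fun k hk => ?_
    rw [show i + 1 + (k : ℤ) = i + ((k + 1 : ℕ) : ℤ) by push_cast; ring,
      show j + 1 + (k : ℤ) = j + ((k + 1 : ℕ) : ℤ) by push_cast; ring]
    rcases Nat.lt_or_ge (k + 1) d with h | h
    · exact (hs _ _).1 hij _ h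
    · rw [show k + 1 = d by omega]; exact hnext _ _ hij
  obtain ⟨-, q, hq1, hq2, hq⟩ := periodic_of_deterministic s VV.ncard (hVV.subset hrange)
    (Set.ncard_le_ncard hrange hVV) hdet
  have heq : ∀ i, e (i + q) = e i := by
    intro i
    have := hnext _ _ (hq (i - d))
    rwa [show i - d + q + (d : ℤ) = i + q by ring, sub_add_cancel] at this
  obtain ⟨c, hc⟩ := Nat.dvd_factorial hq1 hq2
  intro i
  rw [hc]; push_cast
  rw [mul_comm]
  exact apply_add_mul_of_periodic e heq c i

/-- A sequence with finitely many values whose differences `g (i + M) - g i` have period `M` has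
period `M` itself. -/
theorem periodic_of_periodic_difference (g : ℤ → ℚ) (hg : (Set.range g).Finite) (M : ℤ)
    (h : ∀ i, g (i + M + M) - g (i + M) = g (i + M) - g i) (i : ℤ) : g (i + M) = g i := by
  by_contra hne
  -- Along the progression `i + k * M` the values form an arithmetic progression; a nonzero step
  -- would give infinitely many values.
  have hlin : ∀ k : ℕ, g (i + k * M) = g i + k * (g (i + M) - g i) ∧
      g (i + (k + 1) * M) = g i + (k + 1) * (g (i + M) - g i) := by
    intro k
    induction k with
    | zero => simp
    | succ k ih =>
      refine ⟨by push_cast; exact ih.2, ?_⟩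
      have := h (i + k * M)
      rw [show i + k * M + M = i + (k + 1) * M by ring,
        show i + (k + 1) * M + M = i + ((k + 1 : ℕ) + 1) * M by push_cast; ring] at this
      push_cast at this ⊢
      linarith [ih.1, ih.2]
  have hinj : Function.Injective fun k : ℕ => g (i + k * M) := by
    intro a b hab
    simp only [(hlin a).1, (hlin b).1] at hab
    have h0 : g (i + M) - g i ≠ 0 := sub_ne_zero.2 hne
    have := mul_right_cancel₀ h0 (add_left_cancel hab)
    exact_mod_cast this
  exact Set.infinite_range_of_injective hinj
    (hg.subset (by rintro _ ⟨k, rfl⟩; exact ⟨_, rfl⟩))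

/-! ### Words and their extensions -/

/-- The coloring of `S` read off `f` at the translate `S + x`. -/
def wordAt (f : ℤ × ℤ → A) (S : Set (ℤ × ℤ)) (x : ℤ × ℤ) : S → A := fun s => f (s + x)

theorem wordAt_mem_words (f : ℤ × ℤ → A) (S : Set (ℤ × ℤ)) (x : ℤ × ℤ) :
    wordAt f S x ∈ words f S := ⟨x, rfl⟩

theorem wordAt_mem_of_mem_sft {η f : ℤ × ℤ → A} {S : Set (ℤ × ℤ)} (hf : f ∈ sft η S)
    (x : ℤ × ℤ) : wordAt f S x ∈ words η S := hf (wordAt_mem_words f S x)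

theorem finite_words [Finite A] (η : ℤ × ℤ → A) {S : Set (ℤ × ℤ)} (hS : S.Finite) :
    (words η S).Finite := by
  have : Finite S := hS
  exact Set.toFinite _

theorem image_words (η : ℤ × ℤ → A) {T S : Set (ℤ × ℤ)} (h : T ⊆ S) :
    (fun β : S → A => β ∘ Set.inclusion h) '' words η S = words η T := by
  unfold words
  rw [← Set.range_comp]
  rfl

theorem complexity_mono [Finite A] (η : ℤ × ℤ → A) {T S : Set (ℤ × ℤ)} (h : T ⊆ S)
    (hS : S.Finite) : complexity η T ≤ complexity η S := by
  unfold complexity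
  rw [← image_words η h]
  exact Set.ncard_image_le (finite_words η hS)

/-- Existence of an extension is automatic, so being generated amounts to injectivity of the
restriction of words from `S` to `S \ {x}`; `isGenerated_of_word_ext` is the converse. -/
theorem IsGenerated.word_ext {η : ℤ × ℤ → A} {S : Set (ℤ × ℤ)} {x : ℤ × ℤ}
    (h : IsGenerated η S x) {β₁ β₂ : S → A} (h₁ : β₁ ∈ words η S) (h₂ : β₂ ∈ words η S)
    (heq : ∀ s : S, (s : ℤ × ℤ) ≠ x → β₁ s = β₂ s) : β₁ = β₂ := by
  have hmem : β₁ ∘ Set.inclusion (Set.sdiff_subset : S \ {x} ⊆ S) ∈ words η (S \ {x}) := by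
    rw [← image_words η Set.sdiff_subset]; exact ⟨β₁, h₁, rfl⟩
  obtain ⟨β, -, hβ⟩ := h _ hmem
  exact (hβ β₁ ⟨h₁, fun t => rfl⟩).trans
    (hβ β₂ ⟨h₂, fun t => (heq ⟨t, t.2.1⟩ fun h => t.2.2 h).symm⟩).symm

theorem isGenerated_of_word_ext {η : ℤ × ℤ → A} {S : Set (ℤ × ℤ)} {x : ℤ × ℤ}
    (h : ∀ β₁ ∈ words η S, ∀ β₂ ∈ words η S,
      (∀ s : S, (s : ℤ × ℤ) ≠ x → β₁ s = β₂ s) → β₁ = β₂) : IsGenerated η S x := by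
  rintro _ ⟨y, rfl⟩
  refine ⟨wordAt η S y, ⟨wordAt_mem_words _ _ _, fun t => rfl⟩, fun β hβ => ?_⟩
  refine h _ hβ.1 _ (wordAt_mem_words _ _ _) fun s hs => ?_
  exact hβ.2 ⟨s, s.2, hs⟩

theorem IsGenerated.eq_of_eq {η g₁ g₂ : ℤ × ℤ → A} {S : Set (ℤ × ℤ)} {x : ℤ × ℤ}
    (h : IsGenerated η S x) (hx : x ∈ S) (h₁ : g₁ ∈ sft η S) (h₂ : g₂ ∈ sft η S)
    (y₁ y₂ : ℤ × ℤ) (heq : ∀ s ∈ S, s ≠ x → g₁ (s + y₁) = g₂ (s + y₂)) :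
    g₁ (x + y₁) = g₂ (x + y₂) :=
  congrFun (h.word_ext (wordAt_mem_of_mem_sft h₁ y₁) (wordAt_mem_of_mem_sft h₂ y₂)
    fun s hs => heq s s.2 hs) ⟨x, hx⟩

/-- Each point of `F` has at least two preimages in `E`, and off `E` the map `r` is a bijection onto
the image minus `F`. -/
theorem ncard_fork {X Y : Type*} (s : Set X) (hs : s.Finite) (r : X → Y) (F : Set Y) (E : Set X)
    (hF : F = {y | ∃ a ∈ s, ∃ b ∈ s, a ≠ b ∧ r a = y ∧ r b = y}) (hE : E = {a ∈ s | r a ∈ F}) :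
    2 * F.ncard ≤ E.ncard ∧ s.ncard + F.ncard = (r '' s).ncard + E.ncard := by
  have hEs : E ⊆ s := by rw [hE]; exact Set.sep_subset _ _
  have hEf := hs.subset hEs
  have hFr : F ⊆ r '' s := by
    rw [hF]; rintro y ⟨a, ha, -, -, -, h, -⟩; exact ⟨a, ha, h⟩
  have hFf := (hs.image r).subset hFr
  constructor
  · have hex : ∀ y : F, ∃ a ∈ s, ∃ b ∈ s, a ≠ b ∧ r a = y ∧ r b = y := fun y => (Set.ext_iff.1 hF y).1 y.2
    choose a ha b hb hab hra hrb using hex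
    have hai : Function.Injective a := fun y z h => Subtype.ext (by rw [← hra, ← hra, h])
    have hbi : Function.Injective b := fun y z h => Subtype.ext (by rw [← hrb, ← hrb, h])
    have hsub : Set.range a ∪ Set.range b ⊆ E := by
      rw [hE]
      rintro _ (⟨y, rfl⟩ | ⟨y, rfl⟩)
      · exact ⟨ha y, by rw [hra]; exact y.2⟩
      · exact ⟨hb y, by rw [hrb]; exact y.2⟩
    have hdis : Disjoint (Set.range a) (Set.range b) := by
      rw [Set.disjoint_left]
      rintro _ ⟨y, rfl⟩ ⟨z, hz⟩
      have : y = z := Subtype.ext (by rw [← hra, ← hrb, hz])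
      exact hab y (by rw [← hz, this])
    have h1 := Set.ncard_le_ncard hsub hEf
    rw [Set.ncard_union_eq hdis (hEf.subset (Set.subset_union_left.trans hsub))
      (hEf.subset (Set.subset_union_right.trans hsub)), ← Set.image_univ, ← Set.image_univ,
      Set.ncard_image_of_injective _ hai, Set.ncard_image_of_injective _ hbi, Set.ncard_univ,
      Nat.card_coe_set_eq] at h1
    omega
  · have h1 : r '' (s \ E) = (r '' s) \ F := by
      ext y
      constructor
      · rintro ⟨a, ⟨ha, haE⟩, rfl⟩
        exact ⟨⟨a, ha, rfl⟩, fun h => haE (by rw [hE]; exact ⟨ha, h⟩)⟩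
      · rintro ⟨⟨a, ha, rfl⟩, h⟩
        refine ⟨a, ⟨ha, fun haE => h ?_⟩, rfl⟩
        rw [hE] at haE; exact haE.2
    have h2 : Set.InjOn r (s \ E) := by
      rintro a ⟨ha, haE⟩ b ⟨hb, -⟩ hab
      by_contra hne
      refine haE ?_
      rw [hE]
      refine ⟨ha, ?_⟩
      rw [hF]
      exact ⟨a, ha, b, hb, hne, rfl, hab.symm⟩
    have h3 := h2.ncard_image
    rw [h1] at h3
    have h4 := Set.ncard_sdiff_add_ncard_of_subset hEs hs
    have h5 := Set.ncard_sdiff_add_ncard_of_subset hFr (hs.image r)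
    omega

/-- The `η`-colorings of `T` with at least two extensions to an `η`-coloring of `S`. -/
def forkWords (η : ℤ × ℤ → A) {T S : Set (ℤ × ℤ)} (h : T ⊆ S) : Set (T → A) :=
  {α | ∃ β₁ ∈ words η S, ∃ β₂ ∈ words η S, β₁ ≠ β₂ ∧ β₁ ∘ Set.inclusion h = α ∧
    β₂ ∘ Set.inclusion h = α}

/-- With `F` forking words and `E` extensions of them, `ncard_fork` gives `2 * F ≤ E ≤ F + K`, so
both bounds follow. -/
theorem ncard_forkWords_le [Finite A] (η : ℤ × ℤ → A) {T S : Set (ℤ × ℤ)} (h : T ⊆ S)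
    (hS : S.Finite) {K : ℕ} (hK : complexity η S ≤ complexity η T + K) :
    (forkWords η h).ncard ≤ K ∧
      {β ∈ words η S | β ∘ Set.inclusion h ∈ forkWords η h}.ncard ≤ 2 * K := by
  obtain ⟨h1, h2⟩ := ncard_fork (words η S) (finite_words η hS)
    (fun β : S → A => β ∘ Set.inclusion h) (forkWords η h) _ rfl rfl
  rw [image_words] at h2
  unfold complexity at hK
  omega

/-! ### Coordinates along and across a primitive vector -/

theorem cross_add (v y z : ℤ × ℤ) : cross v (y + z) = cross v y + cross v z := by
  simp only [cross, Prod.fst_add, Prod.snd_add]; ring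

theorem cross_sub (v y z : ℤ × ℤ) : cross v (y - z) = cross v y - cross v z := by
  simp only [cross, Prod.fst_sub, Prod.snd_sub]; ring

theorem cross_smul (v : ℤ × ℤ) (i : ℤ) (z : ℤ × ℤ) : cross v (i • z) = i * cross v z := by
  simp only [cross, Prod.smul_fst, Prod.smul_snd, smul_eq_mul]; ring

theorem cross_self (v : ℤ × ℤ) : cross v v = 0 := by simp only [cross]; ring

theorem cross_add_smul_self (v z : ℤ × ℤ) (i : ℤ) : cross v (z + i • v) = cross v z := by
  rw [cross_add, cross_smul, cross_self]; ring

theorem exists_cross_eq_one {v : ℤ × ℤ} (hv : IsCoprime v.1 v.2) : ∃ u, cross v u = 1 := by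
  obtain ⟨a, b, h⟩ := hv
  exact ⟨(-b, a), by simp only [cross]; linarith⟩

/-- The point with coordinates `i` along `v` and `t` along `u`. -/
def pt (v u : ℤ × ℤ) (i t : ℤ) : ℤ × ℤ := i • v + t • u

theorem cross_pt {v u : ℤ × ℤ} (h : cross v u = 1) (i t : ℤ) : cross v (pt v u i t) = t := by
  rw [pt, cross_add, cross_smul, cross_smul, cross_self, h]; ring

theorem pt_add (v u : ℤ × ℤ) (i j s t : ℤ) :
    pt v u i s + pt v u j t = pt v u (i + j) (s + t) := by
  simp only [pt, add_smul]; abel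

theorem pt_add_smul (v u : ℤ × ℤ) (i t k : ℤ) : pt v u i t + k • v = pt v u (i + k) t := by
  simp only [pt, add_smul]; abel

theorem eq_pt {v u : ℤ × ℤ} (h : cross v u = 1) (z : ℤ × ℤ) :
    z = pt v u (cross z u) (cross v z) := by
  simp only [cross] at h
  ext <;> simp only [pt, cross, Prod.fst_add, Prod.snd_add, Prod.smul_fst, Prod.smul_snd,
    smul_eq_mul]
  · linear_combination (-z.1) * h
  · linear_combination (-z.2) * h

theorem pt_injective {v u : ℤ × ℤ} (h : cross v u = 1) {i j s t : ℤ}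
    (he : pt v u i s = pt v u j t) : i = j ∧ s = t := by
  have hst : s = t := by rw [← cross_pt h i s, he, cross_pt h]
  subst hst
  have h2 : cross (pt v u i s) u = cross (pt v u j s) u := by rw [he]
  have h3 : ∀ i, cross (pt v u i s) u = i := fun i => by
    have : cross (pt v u i s) u = i * cross v u := by
      simp only [cross, pt, Prod.fst_add, Prod.snd_add, Prod.smul_fst, Prod.smul_snd,
        smul_eq_mul]; ring
    rw [this, h, mul_one]
  rw [h3, h3] at h2
  exact ⟨h2, rfl⟩

/-! ### Layered sets: forking words and periodic strips. -/

/-- `f` has period `q • v` on the lines `cross v = c` with `a ≤ c ≤ b`. -/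
def LevelPeriodic (f : ℤ × ℤ → A) (v : ℤ × ℤ) (a b q : ℤ) : Prop :=
  ∀ z, a ≤ cross v z → cross v z ≤ b → f (z + q • v) = f z

/-- A set `S` whose bottom line in direction `v` consists of `W` consecutive points with
`η`-generated endpoints, followed by `D` lines with at least `W - 1` consecutive points each, such
that `S` has fewer than `W` more colorings than `S` without its bottom line. The bottom line has
level `m`, and `a t` is the first coordinate of the leftmost point on the line of level `t`. -/
structure IsLayered (η : ℤ × ℤ → A) (v u : ℤ × ℤ) (S : Set (ℤ × ℤ)) (m : ℤ) (D W : ℕ)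
    (a : ℤ → ℤ) : Prop where
  finite : S.Finite
  cross_eq : cross v u = 1
  two_le : 2 ≤ W
  one_le : 1 ≤ D
  level_ge : ∀ s ∈ S, m ≤ cross v s
  level_le : ∀ s ∈ S, cross v s ≤ m + D
  bottom : ∀ s ∈ S, cross v s = m → ∃ k : ℕ, k < W ∧ s = pt v u (a m + k) m
  bottom_mem : ∀ k : ℕ, k < W → pt v u (a m + k) m ∈ S
  row_mem : ∀ t, m < t → t ≤ m + D → ∀ k : ℕ, k + 1 < W → pt v u (a t + k) t ∈ S
  gen_left : IsGenerated η S (pt v u (a m) m)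
  gen_right : IsGenerated η S (pt v u (a m + (W - 1 : ℕ)) m)
  complexity_lt : complexity η S < complexity η (S \ face v S) + W

namespace IsLayered

variable {η : ℤ × ℤ → A} {v u : ℤ × ℤ} {S : Set (ℤ × ℤ)} {m : ℤ} {D W : ℕ} {a : ℤ → ℤ}

theorem mem_face (h : IsLayered η v u S m D W a) {s : ℤ × ℤ} :
    s ∈ face v S ↔ s ∈ S ∧ cross v s = m := by
  have hW := h.two_le
  constructor
  · rintro ⟨hs, hmin⟩
    refine ⟨hs, le_antisymm ?_ (h.level_ge s hs)⟩
    have := hmin _ (h.bottom_mem 0 (by omega))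
    rwa [cross_pt h.cross_eq] at this
  · rintro ⟨hs, hm⟩
    exact ⟨hs, fun y hy => hm ▸ h.level_ge y hy⟩

theorem mem_diff (h : IsLayered η v u S m D W a) {s : ℤ × ℤ} :
    s ∈ S \ face v S ↔ s ∈ S ∧ m < cross v s := by
  rw [Set.mem_sdiff, h.mem_face]
  constructor
  · rintro ⟨hs, hn⟩
    exact ⟨hs, lt_of_le_of_ne (h.level_ge s hs) fun e => hn ⟨hs, e.symm⟩⟩
  · rintro ⟨hs, hn⟩
    exact ⟨hs, fun e => hn.ne' e.2⟩

theorem cross_add_pt (h : IsLayered η v u S m D W a) (s : ℤ × ℤ) (i t : ℤ) :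
    cross v (s + pt v u i t) = cross v s + t := by
  rw [cross_add, cross_pt h.cross_eq]

/-- Two elements of `X_S(η)` that agree on a strip and on `W` consecutive points of the line below
it agree on this line. -/
theorem eq_on_line (h : IsLayered η v u S m D W a) {g₁ g₂ : ℤ × ℤ → A} (h₁ : g₁ ∈ sft η S)
    (h₂ : g₂ ∈ sft η S) {t : ℤ}
    (hstrip : ∀ z, t < cross v z → cross v z ≤ t + D → g₁ z = g₂ z) (i₀ : ℤ)
    (hwin : ∀ k : ℕ, k < W → g₁ (pt v u (i₀ + k) t) = g₂ (pt v u (i₀ + k) t)) :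
    ∀ z, cross v z = t → g₁ z = g₂ z := by
  have hW := h.two_le
  -- Agreement on a window of `W` points slides one step right by `gen_right` and one step left by
  -- `gen_left`, the strip above supplying the rest of `S`.
  let Q : ℤ → Prop := fun i => ∀ k : ℕ, k < W → g₁ (pt v u (i + k) t) = g₂ (pt v u (i + k) t)
  have hoff : ∀ i, ∀ s ∈ S, cross v s ≠ m →
      g₁ (s + pt v u (i - a m) (t - m)) = g₂ (s + pt v u (i - a m) (t - m)) := by
    intro i s hs hne
    have h3 := h.level_ge s hs
    have h4 := h.level_le s hs
    apply hstrip <;> rw [h.cross_add_pt] <;> omega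
  have hpt : ∀ i k : ℤ, pt v u (a m + k) m + pt v u (i - a m) (t - m) = pt v u (i + k) t := by
    intro i k
    rw [pt_add]; congr 1 <;> ring
  have hR : ∀ i, Q i → Q (i + 1) := by
    intro i hi k hk
    rcases Nat.lt_or_ge (k + 1) W with hk1 | hk1
    · have := hi (k + 1) hk1
      rwa [show i + ((k + 1 : ℕ) : ℤ) = i + 1 + k by push_cast; ring] at this
    · have := h.gen_right.eq_of_eq (h.bottom_mem _ (by omega)) h₁ h₂
        (pt v u (i + 1 - a m) (t - m)) (pt v u (i + 1 - a m) (t - m)) (by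
          intro s hs hne
          by_cases hm : cross v s = m
          · obtain ⟨l, hl, rfl⟩ := h.bottom s hs hm
            have hlne : l ≠ W - 1 := fun e => hne (by rw [e])
            have := hi (l + 1) (by omega)
            rw [hpt]
            rwa [show i + ((l + 1 : ℕ) : ℤ) = i + 1 + l by push_cast; ring] at this
          · exact hoff _ s hs hm)
      rw [hpt] at this
      rwa [show k = W - 1 by omega]
  have hL : ∀ i, Q i → Q (i - 1) := by
    intro i hi k hk
    rcases Nat.eq_zero_or_pos k with rfl | hk1
    · have := h.gen_left.eq_of_eq (by simpa using h.bottom_mem 0 (by omega)) h₁ h₂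
        (pt v u (i - 1 - a m) (t - m)) (pt v u (i - 1 - a m) (t - m)) (by
          intro s hs hne
          by_cases hm : cross v s = m
          · obtain ⟨l, hl, rfl⟩ := h.bottom s hs hm
            have hlne : l ≠ 0 := fun e => hne (by simp [e])
            have := hi (l - 1) (by omega)
            rw [hpt]
            rwa [show i + ((l - 1 : ℕ) : ℤ) = i - 1 + l by
              rw [Nat.cast_sub (by omega)]; push_cast; ring] at this
          · exact hoff _ s hs hm)
      have e := hpt (i - 1) 0
      rw [add_zero] at e
      rw [e] at this
      simpa using this
    · have := hi (k - 1) (by omega)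
      rwa [show i + ((k - 1 : ℕ) : ℤ) = i - 1 + k by
        rw [Nat.cast_sub (by omega)]; push_cast; ring] at this
  have hQ : ∀ k : ℤ, Q (i₀ + k) := by
    intro k
    induction k using Int.induction_on with
    | zero => simpa using hwin
    | succ k ih => simpa [add_assoc] using hR _ ih
    | pred k ih =>
      have := hL _ ih
      rwa [show i₀ + -(k : ℤ) - 1 = i₀ + (-(k : ℤ) - 1) by ring] at this
  intro z hz
  have := hQ (cross z u - i₀) 0 (by omega)
  rw [show i₀ + (cross z u - i₀) + ((0 : ℕ) : ℤ) = cross z u by push_cast; ring] at this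
  have he := eq_pt h.cross_eq z
  rw [hz] at he
  rwa [he]

/-- All colorings read off the strip above the line of level `t` have several extensions. -/
def AllFork (η : ℤ × ℤ → A) (v u : ℤ × ℤ) (S : Set (ℤ × ℤ)) (m : ℤ) (f : ℤ × ℤ → A) (t : ℤ) :
    Prop :=
  ∀ i : ℤ, wordAt f (S \ face v S) (pt v u i (t - m)) ∈
    forkWords η (Set.sdiff_subset : S \ face v S ⊆ S)

/-- If the two extensions coincided at one position, the colorings would agree on `W` consecutive
points and hence, by `eq_on_line`, on the whole line. -/
theorem allFork_of_ne (h : IsLayered η v u S m D W a) {g₁ g₂ : ℤ × ℤ → A} (h₁ : g₁ ∈ sft η S)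
    (h₂ : g₂ ∈ sft η S) {t : ℤ}
    (hstrip : ∀ z, t < cross v z → cross v z ≤ t + D → g₁ z = g₂ z)
    (hne : ∃ z, cross v z = t ∧ g₁ z ≠ g₂ z) : AllFork η v u S m g₁ t := by
  obtain ⟨z, hz, hgz⟩ := hne
  intro i
  refine ⟨_, wordAt_mem_of_mem_sft h₁ (pt v u i (t - m)), _,
    wordAt_mem_of_mem_sft h₂ (pt v u i (t - m)), fun heq => hgz ?_, rfl, ?_⟩
  · refine h.eq_on_line h₁ h₂ hstrip (a m + i) (fun k hk => ?_) z hz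
    have := congrFun heq ⟨_, h.bottom_mem k hk⟩
    simp only [wordAt] at this
    rwa [pt_add, show a m + k + i = a m + i + k by ring, add_sub_cancel] at this
  · funext s
    obtain ⟨hs, hm⟩ := h.mem_diff.1 s.2
    have h4 := h.level_le _ hs
    exact (hstrip ((s : ℤ × ℤ) + pt v u i (t - m)) (by rw [h.cross_add_pt]; omega)
      (by rw [h.cross_add_pt]; omega)).symm

/-- All words read along the strip fork, so at most `W - 1` of them occur, and at most `2 * W - 2`
words of shape `S` occur one line lower. -/
theorem periodic_of_allFork [Finite A] (h : IsLayered η v u S m D W a) {f : ℤ × ℤ → A}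
    (hf : f ∈ sft η S) {t : ℤ} (hfork : AllFork η v u S m f t) :
    (∃ p : ℕ, 1 ≤ p ∧ p ≤ W - 1 ∧ LevelPeriodic f v (t + 1) (t + D) p) ∧
      ∃ q : ℕ, 1 ≤ q ∧ q ≤ 2 * W - 2 ∧ LevelPeriodic f v t (t + D) q := by
  have hW := h.two_le
  obtain ⟨hcard1, hcard2⟩ := ncard_forkWords_le η (Set.sdiff_subset : S \ face v S ⊆ S) h.finite
    (K := W - 1) (by have := h.complexity_lt; omega)
  have : Finite ↑S := h.finite
  have hT : (S \ face v S).Finite := h.finite.subset Set.sdiff_subset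
  have : Finite ↑(S \ face v S) := hT
  let κ : ℤ → (↑(S \ face v S) → A) := fun i => wordAt f (S \ face v S) (pt v u i (t - m))
  -- Each line is shifted by its own starting point `a`, so that the word `κ i` shows the window of
  -- length `W - 1` of all `D` lines at once.
  let y : ℤ → (Fin D → A) := fun i j => f (pt v u (a (m + 1 + (j : ℕ)) + i) (t + 1 + (j : ℕ)))
  have hκr : Set.range κ ⊆ forkWords η (Set.sdiff_subset : S \ face v S ⊆ S) := by
    rintro _ ⟨i, rfl⟩; exact hfork i
  have hwin : ∀ i j, κ i = κ j → ∀ k : ℕ, k < W - 1 → y (i + k) = y (j + k) := by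
    intro i j hij k hk
    funext l
    have hmem : pt v u (a (m + 1 + (l : ℕ)) + k) (m + 1 + (l : ℕ)) ∈ S \ face v S :=
      h.mem_diff.2 ⟨h.row_mem _ (by omega) (by have := l.2; omega) k (by omega),
        by rw [cross_pt h.cross_eq]; omega⟩
    have := congrFun hij ⟨_, hmem⟩
    simp only [κ, wordAt, pt_add] at this
    simp only [y]
    rw [show t + 1 + ((l : ℕ) : ℤ) = m + 1 + (l : ℕ) + (t - m) by ring,
      show ∀ x y z : ℤ, x + (y + z) = x + z + y by intros; ring, this]
    congr 2; ring
  obtain ⟨hall, p, hp1, hp2, hp⟩ := morse_hedlund y (W - 1) κ (Set.toFinite _)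
    ((Set.ncard_le_ncard hκr (Set.toFinite _)).trans hcard1) hwin
  have hy : ∀ z, t < cross v z → cross v z ≤ t + D → ∃ i l, ∀ k : ℤ, f (z + k • v) = y (i + k) l := by
    intro z hz1 hz2
    have hl : (((cross v z - t - 1).toNat : ℕ) : ℤ) = cross v z - t - 1 :=
      Int.toNat_of_nonneg (by omega)
    refine ⟨cross z u - a (m + (cross v z - t)), ⟨(cross v z - t - 1).toNat, by omega⟩,
      fun k => ?_⟩
    simp only [y, hl]
    have he := eq_pt h.cross_eq z
    conv_lhs => rw [he, pt_add_smul]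
    congr 2
    · rw [show m + 1 + (cross v z - t - 1) = m + (cross v z - t) by ring]; ring
    · ring
  have hshift : ∀ i j, κ i = κ j → ∀ z, t < cross v z → cross v z ≤ t + D → ∀ k : ℤ,
      f (z + (i + k) • v) = f (z + (j + k) • v) := by
    intro i j hij z hz1 hz2 k
    obtain ⟨i₀, l, hyl⟩ := hy z hz1 hz2
    rw [hyl, hyl]
    have := hall i j hij (i₀ + k)
    rw [show i₀ + (i + k) = i + (i₀ + k) by ring, show i₀ + (j + k) = j + (i₀ + k) by ring, this]
  refine ⟨⟨p, hp1, hp2, fun z hz1 hz2 => ?_⟩, ?_⟩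
  · obtain ⟨i₀, l, hyl⟩ := hy z (by omega) hz2
    have := hyl 0
    rw [zero_smul, add_zero, add_zero] at this
    rw [hyl, hp, this]
  -- The words of shape `S` now include the bottom line. Each determines the next: equality above
  -- the bottom line shifts by `hshift`, and the new right endpoint is generated.
  let τ : ℤ → (S → A) := fun i => wordAt f S (pt v u i (t - m))
  have hτκ : ∀ i j, τ i = τ j → κ i = κ j := by
    intro i j hij
    funext s
    exact congrFun hij ⟨s, s.2.1⟩
  have hτr : Set.range τ ⊆ {β ∈ words η S | β ∘ Set.inclusion Set.sdiff_subset ∈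
      forkWords η (Set.sdiff_subset : S \ face v S ⊆ S)} := by
    rintro _ ⟨i, rfl⟩
    exact ⟨wordAt_mem_of_mem_sft hf _, hfork i⟩
  have hdet : ∀ i j, τ i = τ j → τ (i + 1) = τ (j + 1) := by
    intro i j hij
    refine h.gen_right.word_ext (wordAt_mem_of_mem_sft hf _) (wordAt_mem_of_mem_sft hf _)
      fun s hs => ?_
    simp only [τ, wordAt]
    by_cases hm : cross v s = m
    · obtain ⟨l, hl, hsl⟩ := h.bottom s s.2 hm
      have hlne : l ≠ W - 1 := fun e => hs (by rw [hsl, e])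
      have := congrFun hij ⟨_, h.bottom_mem (l + 1) (by omega)⟩
      simp only [τ, wordAt, pt_add] at this
      rw [hsl, pt_add, pt_add]
      rw [show a m + (l : ℤ) + (i + 1) = a m + ((l + 1 : ℕ) : ℤ) + i by push_cast; ring, this]
      congr 2; push_cast; ring
    · have h1 := h.level_ge s s.2
      have h2 := h.level_le s s.2
      have := hshift i j (hτκ i j hij) (s + pt v u 0 (t - m)) (by rw [h.cross_add_pt]; omega)
        (by rw [h.cross_add_pt]; omega) 1
      rw [add_assoc, add_assoc, pt_add_smul, pt_add_smul, zero_add, zero_add] at this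
      exact this
  obtain ⟨-, q, hq1, hq2, hq⟩ := periodic_of_deterministic τ (2 * (W - 1)) (Set.toFinite _)
    ((Set.ncard_le_ncard hτr (Set.toFinite _)).trans hcard2) hdet
  refine ⟨q, hq1, by omega, fun z hz1 hz2 => ?_⟩
  have hmem : pt v u (a (cross v z - t + m)) (cross v z - t + m) ∈ S := by
    rcases eq_or_lt_of_le hz1 with he | hlt
    · simpa [← he] using h.bottom_mem 0 (by omega)
    · simpa using h.row_mem (cross v z - t + m) (by omega) (by omega) 0 (by omega)
  have := congrFun (hq (cross z u - a (cross v z - t + m))) ⟨_, hmem⟩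
  simp only [τ, wordAt, pt_add] at this
  have he := eq_pt h.cross_eq z
  conv_lhs => rw [he, pt_add_smul]
  conv_rhs => rw [he]
  convert this using 3 <;> ring

theorem sft_translate {f : ℤ × ℤ → A} (hf : f ∈ sft η S) (x : ℤ × ℤ) :
    (fun z => f (z + x)) ∈ sft η S := by
  rintro _ ⟨y, rfl⟩
  refine hf ⟨y + x, ?_⟩
  funext s
  simp only [add_assoc]

/-- Without forking everywhere, `f` and its translate by `q • v`, which agree on the strip, must
agree on the line below. -/
theorem periodic_below (h : IsLayered η v u S m D W a) {f : ℤ × ℤ → A}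
    (hf : f ∈ sft η S) {t : ℤ} (hfork : ¬ AllFork η v u S m f t) {q : ℤ}
    (hq : LevelPeriodic f v (t + 1) (t + D) q) : LevelPeriodic f v t (t + D) q := by
  intro z hz1 hz2
  rcases eq_or_lt_of_le hz1 with he | hlt
  · by_contra hne
    exact hfork (h.allFork_of_ne hf (sft_translate hf (q • v))
      (fun y hy1 hy2 => (hq y (by omega) hy2).symm) ⟨z, he.symm, fun e => hne e.symm⟩)
  · exact hq z (by omega) hz2

end IsLayered

/-! ### Affine relations, global periods and propagation to all strips. -/

/-- If `η` has at most `|S|` colorings of `S`, then the elements of `X_S(η)` satisfy a common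
nontrivial affine relation with support in `S`. -/
theorem exists_relation [Finite A] (η : ℤ × ℤ → A) {S : Set (ℤ × ℤ)} (hS : S.Finite)
    (hc : complexity η S ≤ S.ncard) (enc : A → ℚ) :
    ∃ (b₀ : ℚ) (b : ℤ × ℤ → ℚ), (∃ s ∈ hS.toFinset, b s ≠ 0) ∧
      ∀ f ∈ sft η S, ∀ x, b₀ + ∑ s ∈ hS.toFinset, b s * enc (f (s + x)) = 0 := by
  classical
  have : Fintype ↑S := hS.fintype
  have : Fintype ↑(words η S) := (finite_words η hS).fintype
  -- There are `|S| + 1` unknown coefficients (`none` is the constant term) and at most `|S|`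
  -- equations, one for each word.
  let Φ : (Option ↑S → ℚ) →ₗ[ℚ] (↑(words η S) → ℚ) :=
    { toFun := fun c β => c none + ∑ s : ↑S, c (some s) * enc (β.1 s)
      map_add' := fun c d => by
        funext β
        simp only [Pi.add_apply, add_mul, Finset.sum_add_distrib]; ring
      map_smul' := fun r c => by
        funext β
        simp only [Pi.smul_apply, smul_eq_mul, RingHom.id_apply, mul_add, Finset.mul_sum,
          mul_assoc] }
  have hker : LinearMap.ker Φ ≠ ⊥ := by
    apply LinearMap.ker_ne_bot_of_finrank_lt
    rw [Module.finrank_fintype_fun_eq_card, Module.finrank_fintype_fun_eq_card, Fintype.card_option,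
      ← Nat.card_eq_fintype_card, ← Nat.card_eq_fintype_card, Nat.card_coe_set_eq,
      Nat.card_coe_set_eq]
    exact Nat.lt_succ_of_le hc
  obtain ⟨c, hcker, hc0⟩ := Submodule.exists_mem_ne_zero_of_ne_bot hker
  have hΦ : ∀ β : ↑(words η S), c none + ∑ s : ↑S, c (some s) * enc (β.1 s) = 0 := fun β =>
    congrFun (LinearMap.mem_ker.1 hcker) β
  refine ⟨c none, fun s => if hs : s ∈ S then c (some ⟨s, hs⟩) else 0, ?_, ?_⟩
  -- If all coefficients at points vanish, a single word forces the constant term to vanish too.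
  · by_contra! hcon
    have hz : ∀ s : ↑S, c (some s) = 0 := fun s => by
      have := hcon s (hS.mem_toFinset.2 s.2)
      rwa [dif_pos s.2] at this
    refine hc0 (funext fun o => ?_)
    cases o with
    | none =>
      have := hΦ ⟨_, wordAt_mem_words η S 0⟩
      simpa [hz] using this
    | some s => exact hz s
  · intro f hf x
    have := hΦ ⟨_, wordAt_mem_of_mem_sft hf x⟩
    rw [← this]
    congr 1
    rw [← Finset.sum_coe_sort hS.toFinset]
    refine Fintype.sum_equiv (Equiv.subtypeEquivRight fun s => hS.mem_toFinset) _ _ fun s => ?_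
    have hs : (s : ℤ × ℤ) ∈ S := hS.mem_toFinset.1 s.2
    simp only [dif_pos hs, wordAt, Equiv.subtypeEquivRight_apply_coe]
    rfl

/-- An affine relation transports periodicity in direction `v` to the line of level `t` from the
other lines which the relation links to it. -/
theorem exists_period_of_relation {v u : ℤ × ℤ} (hvu : cross v u = 1) (I : Finset (ℤ × ℤ))
    (b₀ : ℚ) (b : ℤ × ℤ → ℚ) (c : ℤ) (hc : ∃ s ∈ I, cross v s = c ∧ b s ≠ 0) (V : Set ℚ)
    (hV : V.Finite) :
    ∃ N : ℕ, 1 ≤ N ∧ ∀ F : ℤ × ℤ → ℚ, (∀ z, F z ∈ V) →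
      (∀ x, b₀ + ∑ s ∈ I, b s * F (s + x) = 0) → ∀ M : ℤ, (N : ℤ) ∣ M → ∀ t,
      (∀ s ∈ I, b s ≠ 0 → cross v s ≠ c → ∀ x, cross v x = t - c →
        F (s + x + M • v) = F (s + x)) → ∀ z, cross v z = t → F (z + M • v) = F z := by
  classical
  let I' := I.filter fun s => cross v s = c
  have hI' : ∀ s ∈ I', s = pt v u (cross s u) c := fun s hs => by
    have := eq_pt hvu s
    rwa [(Finset.mem_filter.1 hs).2] at this
  have hinj : Set.InjOn (fun s => cross s u) (I' : Set (ℤ × ℤ)) := by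
    intro s hs s' hs' h
    rw [hI' s hs, hI' s' hs']
    exact congrArg (fun i => pt v u i c) h
  obtain ⟨N, hN1, hN⟩ := exists_period_of_recurrence (I'.image fun s => cross s u)
    (fun i => b (pt v u i c)) (by
      obtain ⟨s, hs, hsc, hbs⟩ := hc
      have hs' : s ∈ I' := Finset.mem_filter.2 ⟨hs, hsc⟩
      exact ⟨_, Finset.mem_image_of_mem _ hs', by rwa [← hI' s hs']⟩)
    (Set.image2 (fun x y => x - y) V V) (hV.image2 _ hV)
  refine ⟨N, hN1, fun F hF hrel M hNM t hper => ?_⟩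
  -- In the relation for the difference of `F` and its translate by `M • v`, the constant and the
  -- lines already periodic cancel. What remains is a one-dimensional recurrence on the line of
  -- level `t`.
  have he := hN (fun j => F (pt v u j t + M • v) - F (pt v u j t))
    (fun j => ⟨_, hF _, _, hF _, rfl⟩) (fun j => by
      rw [Finset.sum_image hinj]
      have h1 := hrel (pt v u j (t - c) + M • v)
      have h2 := hrel (pt v u j (t - c))
      have h3 : ∑ s ∈ I, b s * (F (s + pt v u j (t - c) + M • v) - F (s + pt v u j (t - c))) = 0 := by
        simp only [mul_sub, Finset.sum_sub_distrib]
        simp only [← add_assoc] at h1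
        linarith
      rw [← Finset.sum_filter_add_sum_filter_not I (fun s => cross v s = c)] at h3
      have h4 : ∑ s ∈ I.filter (fun s => ¬ cross v s = c),
          b s * (F (s + pt v u j (t - c) + M • v) - F (s + pt v u j (t - c))) = 0 := by
        refine Finset.sum_eq_zero fun s hs => ?_
        obtain ⟨hs, hsc⟩ := Finset.mem_filter.1 hs
        by_cases hb : b s = 0
        · rw [hb, zero_mul]
        · rw [hper s hs hb hsc _ (cross_pt hvu _ _), sub_self, mul_zero]
      rw [h4, add_zero] at h3
      rw [← h3]
      refine Finset.sum_congr rfl fun s hs => ?_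
      have h5 : s + pt v u j (t - c) = pt v u (cross s u + j) t := by
        conv_lhs => rw [hI' s hs]
        rw [pt_add, add_sub_cancel]
      rw [h5, ← hI' s hs])
  obtain ⟨l, rfl⟩ := hNM
  have heM := apply_add_mul_of_periodic
    (fun j => F (pt v u j t + ((N : ℤ) * l) • v) - F (pt v u j t)) he l
  have := periodic_of_periodic_difference (fun i => F (pt v u i t))
    (hV.subset (by rintro _ ⟨i, rfl⟩; exact hF _)) (N * l) (fun i => by
      have := heM i
      simp only [pt_add_smul] at this
      rwa [mul_comm l] at this)
  intro z hz
  have hz' := eq_pt hvu z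
  rw [hz] at hz'
  rw [hz', pt_add_smul]
  exact this _

namespace IsLayered

variable {η : ℤ × ℤ → A} {v u : ℤ × ℤ} {S : Set (ℤ × ℤ)} {m : ℤ} {D W : ℕ} {a : ℤ → ℤ}

/-- The lowest and the highest line with a nonzero coefficient in the relation are at most `D`
levels apart. Solving for the lowest extends a periodic strip of width `D` downwards, solving for
the highest extends it upwards. -/
theorem exists_global_period [Finite A] (h : IsLayered η v u S m D W a)
    (hc : complexity η S ≤ S.ncard) :
    ∃ N : ℕ, 1 ≤ N ∧ ∀ f ∈ sft η S, ∀ M : ℤ, (N : ℤ) ∣ M → ∀ t,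
      LevelPeriodic f v (t + 1) (t + D) M → ∀ z, f (z + M • v) = f z := by
  classical
  obtain ⟨r, ⟨e⟩⟩ := Finite.exists_equiv_fin A
  let enc : A → ℚ := fun x => ((e x : ℕ) : ℚ)
  have henc : Function.Injective enc := fun x y hxy => by
    have : ((e x : ℕ) : ℚ) = ((e y : ℕ) : ℚ) := hxy
    exact e.injective (Fin.ext (by exact_mod_cast this))
  obtain ⟨b₀, b, ⟨s₀, hs₀, hbs₀⟩, hrel⟩ := exists_relation η h.finite hc enc
  let J := (h.finite.toFinset.filter fun s => b s ≠ 0).image (cross v)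
  have hJ : J.Nonempty := ⟨cross v s₀, Finset.mem_image_of_mem _ (Finset.mem_filter.2 ⟨hs₀, hbs₀⟩)⟩
  have hex : ∀ c ∈ J, ∃ s ∈ h.finite.toFinset, cross v s = c ∧ b s ≠ 0 := by
    intro c hc
    obtain ⟨s, hs, rfl⟩ := Finset.mem_image.1 hc
    exact ⟨s, (Finset.mem_filter.1 hs).1, rfl, (Finset.mem_filter.1 hs).2⟩
  have hmemJ : ∀ s ∈ h.finite.toFinset, b s ≠ 0 → cross v s ∈ J := fun s hs hb =>
    Finset.mem_image_of_mem _ (Finset.mem_filter.2 ⟨hs, hb⟩)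
  have hJlev : ∀ c ∈ J, m ≤ c ∧ c ≤ m + D := by
    intro c hc
    obtain ⟨s, hs, rfl, -⟩ := hex c hc
    exact ⟨h.level_ge s (h.finite.mem_toFinset.1 hs), h.level_le s (h.finite.mem_toFinset.1 hs)⟩
  obtain ⟨N₁, hN₁, hlow⟩ := exists_period_of_relation h.cross_eq h.finite.toFinset b₀ b (J.min' hJ)
    (hex _ (J.min'_mem hJ)) (Set.range enc) (Set.finite_range enc)
  obtain ⟨N₂, hN₂, hupp⟩ := exists_period_of_relation h.cross_eq h.finite.toFinset b₀ b (J.max' hJ)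
    (hex _ (J.max'_mem hJ)) (Set.range enc) (Set.finite_range enc)
  refine ⟨N₁ * N₂, Nat.mul_pos hN₁ hN₂, fun f hf M hM t ht => ?_⟩
  have hM₁ : (N₁ : ℤ) ∣ M := (Dvd.intro _ (by push_cast; rfl)).trans hM
  have hM₂ : (N₂ : ℤ) ∣ M := (Dvd.intro_left _ (by push_cast; rfl)).trans hM
  have hlevs : ∀ s ∈ h.finite.toFinset, b s ≠ 0 → J.min' hJ ≤ cross v s ∧ cross v s ≤ J.max' hJ :=
    fun s hs hb => ⟨J.min'_le _ (hmemJ s hs hb), J.le_max' _ (hmemJ s hs hb)⟩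
  have h1 := hJlev _ (J.min'_mem hJ)
  have h2 := hJlev _ (J.max'_mem hJ)
  have hind : ∀ k : ℕ, LevelPeriodic f v (t + 1 - k) (t + D + k) M := by
    intro k
    induction k with
    | zero => simpa using ht
    | succ k ih =>
      intro z hz1 hz2
      push_cast at hz1 hz2
      by_cases hlo : cross v z = t - k
      · refine henc (hlow (fun z => enc (f z)) (fun z => ⟨_, rfl⟩) (hrel f hf) M hM₁ (t - k)
          (fun s hs hb hne x hx => ?_) z hlo)
        have h3 := hlevs s hs hb
        exact congrArg enc (ih (s + x) (by rw [cross_add]; omega) (by rw [cross_add]; omega))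
      · by_cases hhi : cross v z = t + D + k + 1
        · refine henc (hupp (fun z => enc (f z)) (fun z => ⟨_, rfl⟩) (hrel f hf) M hM₂
            (t + D + k + 1) (fun s hs hb hne x hx => ?_) z hhi)
          have h3 := hlevs s hs hb
          exact congrArg enc (ih (s + x) (by rw [cross_add]; omega) (by rw [cross_add]; omega))
        · exact ih z (by omega) (by omega)
  intro z
  exact hind ((cross v z - t).natAbs + 1) z (by omega) (by omega)

/-- If the strip above the line of level `t₀` has a period at most `2 * W - 2`, then so do all
strips of width `D`. -/
theorem strips_periodic [Finite A] (h : IsLayered η v u S m D W a) {f : ℤ × ℤ → A}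
    (hf : f ∈ sft η S) {M : ℕ} (hM : 1 ≤ M) (hfM : ∀ z, f (z + (M : ℤ) • v) = f z) {t₀ : ℤ}
    (h₀ : ∃ q : ℕ, 1 ≤ q ∧ q ≤ 2 * W - 2 ∧ LevelPeriodic f v (t₀ + 1) (t₀ + D) q) (t : ℤ) :
    ∃ q : ℕ, 1 ≤ q ∧ q ≤ 2 * W - 2 ∧ LevelPeriodic f v (t + 1) (t + D) q := by
  have hD := h.one_le
  let Good : ℤ → Prop := fun t =>
    ∃ q : ℕ, 1 ≤ q ∧ q ≤ 2 * W - 2 ∧ LevelPeriodic f v (t + 1) (t + D) q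
  -- Either all words fork, giving a fresh period at most `2 * W - 2`, or the line below inherits
  -- the old period.
  have hstep : ∀ t, Good t → Good (t - 1) := by
    rintro t ⟨q, hq1, hq2, hq⟩
    by_cases hfork : AllFork η v u S m f t
    · obtain ⟨-, q', hq1', hq2', hq'⟩ := h.periodic_of_allFork hf hfork
      exact ⟨q', hq1', hq2', fun z hz1 hz2 => hq' z (by omega) (by omega)⟩
    · exact ⟨q, hq1, hq2, fun z hz1 hz2 =>
        h.periodic_below hf hfork hq z (by omega) (by omega)⟩
  have hdown : ∀ t, Good t → ∀ k : ℕ, Good (t - k) := by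
    intro t ht k
    induction k with
    | zero => simpa using ht
    | succ k ih => simpa [sub_sub] using hstep _ ih
  by_contra hbad
  have hbad' : ∀ k : ℕ, ¬ Good (t + k) := fun k hk => hbad (by simpa using hdown _ hk k)
  -- Above a line where all words fork the period is at most `W - 1`, so below a bad strip the
  -- extension is unique.
  have hnofork : ∀ t, ¬ Good t → ¬ AllFork η v u S m f t := by
    intro t ht hfork
    obtain ⟨⟨p, hp1, hp2, hp⟩, -⟩ := h.periodic_of_allFork hf hfork
    exact ht ⟨p, hp1, by omega, hp⟩
  -- two strips above the line of level `t` carry the same coloring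
  obtain ⟨k₁, k₂, hk, hkeq⟩ := Finite.exists_ne_map_eq_of_infinite
    (fun (k : ℕ) (x : Fin M × Fin D) => f (pt v u (x.1 : ℕ) (t + k + 1 + (x.2 : ℕ))))
  wlog hlt : k₁ < k₂ generalizing k₁ k₂
  · exact this k₂ k₁ hk.symm hkeq.symm (by omega)
  let d : ℤ := k₂ - k₁
  have hagree : ∀ z, t + k₁ < cross v z → cross v z ≤ t + k₁ + D →
      f z = f (z + d • u) := by
    intro z hz1 hz2
    have hMi : ∀ i s, f (pt v u i s) = f (pt v u (i % M) s) := by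
      intro i s
      have := apply_add_mul_of_periodic (fun i => f (pt v u i s)) (q := (M : ℤ))
        (fun i => by rw [← pt_add_smul]; exact hfM _) (i / M) (i % M)
      rw [← this]
      congr 2
      rw [mul_comm, Int.emod_add_mul_ediv]
    have hz := eq_pt h.cross_eq z
    have hr1 := Int.emod_nonneg (cross z u) (show (M : ℤ) ≠ 0 by omega)
    have hr2 := Int.emod_lt_of_pos (cross z u) (show (0 : ℤ) < M by omega)
    have := congrFun hkeq (⟨(cross z u % M).toNat, by omega⟩,
      ⟨(cross v z - t - k₁ - 1).toNat, by omega⟩)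
    simp only [Int.toNat_of_nonneg hr1,
      Int.toNat_of_nonneg (show 0 ≤ cross v z - t - k₁ - 1 by omega)] at this
    rw [← hMi, ← hMi] at this
    rw [hz]
    have hd : pt v u (cross z u) (cross v z) + d • u = pt v u (cross z u) (cross v z + d) := by
      simp only [pt, add_smul]; abel
    rw [hd]
    convert this using 3
    · ring
    · simp only [d]; ring
  -- The agreement of `f` with its translate by `d • u` descends through bad levels by unique
  -- extension. Each new strip then copies a bad strip `d` levels higher and is bad itself, so
  -- badness reaches below `t₀`.
  have hind : ∀ r : ℕ, (∀ z, t + k₁ - r < cross v z → cross v z ≤ t + k₁ + D →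
      f z = f (z + d • u)) ∧ ∀ s, t + k₁ - r ≤ s → ¬ Good s := by
    intro r
    induction r with
    | zero =>
      refine ⟨by simpa using hagree, fun s hs => ?_⟩
      have := hbad' (s - t).toNat
      rwa [Int.toNat_of_nonneg (by push_cast at hs; omega), add_sub_cancel] at this
    | succ r ih =>
      obtain ⟨ih1, ih2⟩ := ih
      have hline : ∀ z, t + k₁ - (r + 1 : ℕ) < cross v z → cross v z ≤ t + k₁ + D →
          f z = f (z + d • u) := by
        intro z hz1 hz2
        push_cast at hz1
        by_contra hne
        have hz : cross v z = t + k₁ - r := by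
          by_contra hz
          exact hne (ih1 z (by omega) hz2)
        exact hnofork _ (ih2 (t + k₁ - r) le_rfl) (h.allFork_of_ne hf (sft_translate hf (d • u))
          (fun y hy1 hy2 => ih1 y hy1 (by omega)) ⟨z, hz, hne⟩)
      refine ⟨hline, fun s hs => ?_⟩
      push_cast at hs
      by_cases hs' : t + k₁ - r ≤ s
      · exact ih2 s hs'
      · have hse : s = t + k₁ - r - 1 := by omega
        rintro ⟨q, hq1, hq2, hq⟩
        refine ih2 (s + d) (by omega) ⟨q, hq1, hq2, fun z hz1 hz2 => ?_⟩
        have hcz : cross v (z - d • u) = cross v z - d := by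
          rw [cross_sub, cross_smul, h.cross_eq, mul_one]
        have hcz' : cross v (z - d • u + (q : ℤ) • v) = cross v z - d := by
          rw [cross_add_smul_self, hcz]
        have e1 := hline (z - d • u) (by push_cast; omega) (by omega)
        have e2 := hline (z - d • u + (q : ℤ) • v) (by push_cast; omega) (by omega)
        have e3 := hq (z - d • u) (by omega) (by omega)
        rw [sub_add_cancel] at e1
        rw [show z - d • u + (q : ℤ) • v + d • u = z + (q : ℤ) • v by abel] at e2
        rw [← e1, ← e2, e3]
  refine (hind (t + k₁ - t₀).natAbs).2 (min t₀ (t + k₁)) (by omega) ?_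
  have := hdown t₀ h₀ (t₀ - min t₀ (t + k₁)).toNat
  rwa [Int.toNat_of_nonneg (by omega), sub_sub_cancel] at this

end IsLayered

/-! ### Half planes, borders and ambiguous colorings. -/

theorem halfPlaneExt_eq {v u : ℤ × ℤ} (hvu : cross v u = 1) (c : ℤ) :
    halfPlaneExt v {z | c ≤ cross v z} = {z | c - 1 ≤ cross v z} := by
  apply Set.Subset.antisymm
  · intro z hz
    refine hz _ ⟨⟨c - 1, rfl⟩, ?_⟩
    refine Set.ssubset_iff_subset_ne.2
      ⟨fun y (hy : c ≤ cross v y) => show c - 1 ≤ cross v y by omega, fun he => ?_⟩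
    have : pt v u 0 (c - 1) ∈ {z | c ≤ cross v z} := by
      rw [he]; exact (cross_pt hvu _ _).ge
    rw [Set.mem_ofPred_eq, cross_pt hvu] at this
    omega
  · rintro z hz K ⟨⟨c', rfl⟩, hK⟩
    obtain ⟨y, hy, hyH⟩ := Set.exists_of_ssubset hK
    simp only [Set.mem_ofPred_eq] at hy hyH hz ⊢
    omega

namespace IsLayered

variable {η : ℤ × ℤ → A} {v u : ℤ × ℤ} {S : Set (ℤ × ℤ)} {m : ℤ} {D W : ℕ} {a : ℤ → ℤ}

theorem ncard_face (h : IsLayered η v u S m D W a) : (face v S).ncard = W := by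
  have : face v S = (fun k : ℕ => pt v u (a m + k) m) '' (Finset.range W : Set ℕ) := by
    ext s
    rw [h.mem_face]
    constructor
    · rintro ⟨hs, hm⟩
      obtain ⟨k, hk, rfl⟩ := h.bottom s hs hm
      exact ⟨k, by simpa using hk, rfl⟩
    · rintro ⟨k, hk, rfl⟩
      exact ⟨h.bottom_mem k (by simpa using hk), cross_pt h.cross_eq _ _⟩
  rw [this, Set.ncard_image_of_injective, Set.ncard_coe_finset, Finset.card_range]
  intro k l hkl
  have := (pt_injective h.cross_eq hkl).1
  omega

theorem diam_diff (h : IsLayered η v u S m D W a) : diam v (S \ face v S) = D := by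
  have hW := h.two_le
  have : cross v '' (S \ face v S) = (Finset.Icc (m + 1) (m + D) : Set ℤ) := by
    ext t
    constructor
    · rintro ⟨s, hs, rfl⟩
      obtain ⟨hs, hm⟩ := h.mem_diff.1 hs
      have := h.level_le s hs
      simp only [Finset.coe_Icc, Set.mem_Icc]
      omega
    · intro ht
      simp only [Finset.coe_Icc, Set.mem_Icc] at ht
      exact ⟨_, h.mem_diff.2 ⟨h.row_mem t (by omega) ht.2 0 (by omega),
        by rw [cross_pt h.cross_eq]; omega⟩, cross_pt h.cross_eq _ _⟩
  rw [diam, this, Set.ncard_coe_finset, Int.card_Icc]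
  omega

/-- The bottom line of `S \ face v S` has level `m + 1` and is moved to level `c`, so the highest
possible level `m + D` goes to `c + D - 1`. -/
theorem border_subset (h : IsLayered η v u S m D W a) (c : ℤ) :
    border v (S \ face v S) {z | c ≤ cross v z} ⊆ {z | c ≤ cross v z ∧ cross v z < c + D} := by
  have hW := h.two_le
  have hD := h.one_le
  rintro z ⟨y, hy1, hy2, s, hs, rfl⟩
  refine ⟨hy1 s hs, ?_⟩
  obtain ⟨hs, hm⟩ := h.mem_diff.1 hs
  have hmem : pt v u (a (m + 1) + (0 : ℕ)) (m + 1) ∈ face v (S \ face v S) := by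
    refine ⟨h.mem_diff.2 ⟨h.row_mem _ (by omega) (by omega) 0 (by omega),
      by rw [cross_pt h.cross_eq]; omega⟩, fun s' hs' => ?_⟩
    rw [cross_pt h.cross_eq]
    have := (h.mem_diff.1 hs').2
    omega
  have h1 := (hy2 _ hmem).2 (pt v u 0 c) (by
    rw [Set.mem_ofPred_eq, cross_pt h.cross_eq])
  rw [cross_add, cross_pt h.cross_eq, cross_pt h.cross_eq] at h1
  have h2 := h.level_le s hs
  rw [cross_add]
  omega

end IsLayered

theorem border_add_smul (v : ℤ × ℤ) (T : Set (ℤ × ℤ)) (c i : ℤ) {z : ℤ × ℤ}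
    (hz : z ∈ border v T {z | c ≤ cross v z}) : z + i • v ∈ border v T {z | c ≤ cross v z} := by
  obtain ⟨y, hy1, hy2, s, hs, rfl⟩ := hz
  refine ⟨y + i • v, fun t ht => ?_, fun t ht => ⟨?_, fun x hx => ?_⟩, s, hs, add_assoc _ _ _⟩
  · rw [← add_assoc, Set.mem_ofPred_eq, cross_add_smul_self]; exact hy1 t ht
  · rw [← add_assoc, Set.mem_ofPred_eq, cross_add_smul_self]; exact hy1 t ht.1
  · rw [← add_assoc, cross_add_smul_self]; exact (hy2 t ht).2 x hx

theorem ne_zero_of_cross {v u : ℤ × ℤ} (hvu : cross v u = 1) : v ≠ 0 := by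
  rintro rfl; simp [cross] at hvu

theorem diam_strip {v u : ℤ × ℤ} (hvu : cross v u = 1) {a b : ℤ} (hab : a ≤ b) :
    (diam v {z | a ≤ cross v z ∧ cross v z ≤ b} : ℤ) = b - a + 1 := by
  have : cross v '' {z | a ≤ cross v z ∧ cross v z ≤ b} = (Finset.Icc a b : Set ℤ) := by
    ext t
    simp only [Finset.coe_Icc, Set.mem_Icc]
    constructor
    · rintro ⟨z, hz, rfl⟩; exact hz
    · intro ht
      exact ⟨pt v u 0 t, by rwa [Set.mem_ofPred_eq, cross_pt hvu], cross_pt hvu _ _⟩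
  rw [diam, this, Set.ncard_coe_finset, Int.card_Icc]
  omega

/-- Periodicity of the colorings that are ambiguous on a half plane. -/
theorem IsLayered.periodic_of_ambiguous [Finite A] {η : ℤ × ℤ → A} {v u : ℤ × ℤ}
    {S : Set (ℤ × ℤ)} {m : ℤ} {D W : ℕ} {a : ℤ → ℤ} (h : IsLayered η v u S m D W a)
    (hc : complexity η S ≤ S.ncard) {H : Set (ℤ × ℤ)} (hH : IsHalfPlane v H) {f : ℤ × ℤ → A}
    (hf : IsHalfPlaneAmbiguous η v S H f) :
    (∃ p : ℤ, PeriodicOn f Set.univ (p • v)) ∧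
      HasPeriodAtMost f (border v (S \ face v S) H) v ((face v S).ncard - 1) ∧
      ∀ B : Set (ℤ × ℤ), IsStrip v B → diam v B = diam v (S \ face v S) →
        HasPeriodAtMost f B v (2 * (face v S).ncard - 2) := by
  obtain ⟨c, rfl⟩ := hH
  obtain ⟨hfS, g₁, hg₁, g₂, hg₂, h1, h2, hne⟩ := hf
  rw [halfPlaneExt_eq h.cross_eq] at hne
  have hv0 := ne_zero_of_cross h.cross_eq
  have hsmul : ∀ p : ℕ, 1 ≤ p → (p : ℤ) • v ≠ 0 := fun p hp =>
    smul_ne_zero (by omega) hv0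
  -- As `g₁` and `g₂` differ at a point of the new line, `f` differs there from one of them and can
  -- be compared with that one.
  have hfork : AllFork η v u S m f (c - 1) := by
    have hz : ∃ z, cross v z = c - 1 ∧ g₁ z ≠ g₂ z := by
      by_contra! hcon
      refine hne fun z hz => ?_
      rcases eq_or_lt_of_le (show c - 1 ≤ cross v z from hz) with he | hlt
      · exact hcon z he.symm
      · have hzH : z ∈ {z | c ≤ cross v z} := show c ≤ cross v z by omega
        rw [h1 hzH, h2 hzH]
    obtain ⟨z, hz, hgz⟩ := hz
    by_cases hfz : f z = g₁ z
    · exact h.allFork_of_ne hfS hg₂ (fun y hy1 hy2 => (h2 (show c ≤ cross v y by omega)).symm)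
        ⟨z, hz, by rwa [hfz]⟩
    · exact h.allFork_of_ne hfS hg₁ (fun y hy1 hy2 => (h1 (show c ≤ cross v y by omega)).symm)
        ⟨z, hz, hfz⟩
  obtain ⟨⟨p, hp1, hp2, hp⟩, -⟩ := h.periodic_of_allFork hfS hfork
  obtain ⟨N, hN1, hN⟩ := h.exists_global_period hc
  have hglobal : ∀ z, f (z + ((p * N : ℕ) : ℤ) • v) = f z := by
    refine hN f hfS _ (Dvd.intro_left (p : ℤ) (by push_cast; rfl)) (c - 1) ?_
    intro z hz1 hz2
    have hper : ∀ i : ℤ, f (z + i • v + (p : ℤ) • v) = f (z + i • v) := fun i =>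
      hp _ (by rwa [cross_add_smul_self]) (by rwa [cross_add_smul_self])
    have := apply_add_mul_of_periodic (fun i : ℤ => f (z + i • v)) (q := (p : ℤ))
      (fun i => by rw [add_smul, ← add_assoc]; exact hper i) N 0
    simp only [zero_smul, add_zero, zero_add] at this
    rw [← this]
    congr 3; push_cast; ring
  have hpN : 1 ≤ p * N := Nat.mul_pos hp1 hN1
  refine ⟨⟨_, hsmul _ hpN, fun z _ => ⟨trivial, hglobal z⟩⟩, ?_, ?_⟩
  · rw [h.ncard_face]
    refine ⟨p, hp1, hp2, hsmul p hp1, fun z hz => ⟨border_add_smul v _ c p hz, ?_⟩⟩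
    obtain ⟨hz1, hz2⟩ := h.border_subset c hz
    exact hp z (by omega) (by omega)
  · rintro B ⟨b₁, b₂, hb, rfl⟩ hdiam
    rw [h.ncard_face]
    have hdiam' := diam_strip h.cross_eq hb
    rw [hdiam, h.diam_diff] at hdiam'
    obtain ⟨q, hq1, hq2, hq⟩ := h.strips_periodic hfS hpN hglobal
      ⟨p, hp1, by omega, hp⟩ (b₁ - 1)
    refine ⟨q, hq1, hq2, hsmul q hq1, fun z hz => ⟨?_, hq z (by have := hz.1; omega) (by have := hz.2; omega)⟩⟩
    rw [Set.mem_ofPred_eq, cross_add_smul_self]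
    exact hz

/-! ### Lattice convexity -/

/-- An open half plane is convex. Closed conditions on integer points are used in this strict form
after lowering the bound by one. -/
theorem convexHull_subset_of_lt (S : Set (ℤ × ℤ)) (α β γ : ℤ)
    (h : ∀ s ∈ S, γ < α * s.1 + β * s.2) {z : ℤ × ℤ}
    (hz : toReal z ∈ convexHull ℝ (toReal '' S)) : γ < α * z.1 + β * z.2 := by
  have hconv : Convex ℝ {y : ℝ × ℝ | (γ : ℝ) < (α : ℝ) * y.1 + (β : ℝ) * y.2} :=
    convex_halfSpace_gt (IsLinearMap.mk (fun x y => by simp only [Prod.fst_add, Prod.snd_add]; ring)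
      (fun c x => by simp only [Prod.smul_fst, Prod.smul_snd, smul_eq_mul]; ring)) _
  have := convexHull_min (by
    rintro _ ⟨s, hs, rfl⟩
    have := h s hs
    simp only [Set.mem_ofPred_eq, toReal]
    exact_mod_cast this) hconv hz
  simp only [Set.mem_ofPred_eq, toReal] at this
  exact_mod_cast this

theorem isLatticeConvex_of_finite {S : Set (ℤ × ℤ)} (hS : S.Finite)
    (h : ∀ z, toReal z ∈ convexHull ℝ (toReal '' S) → z ∈ S) : IsLatticeConvex S :=
  ⟨(hS.image toReal).isClosed_convexHull ℝ, h⟩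

theorem IsLatticeConvex.inter_halfPlane {S S' : Set (ℤ × ℤ)} (hS : IsLatticeConvex S)
    (hfin : S.Finite) (α β γ : ℤ) (h : ∀ s, s ∈ S' ↔ s ∈ S ∧ γ < α * s.1 + β * s.2) :
    IsLatticeConvex S' := by
  have hsub : S' ⊆ S := fun s hs => ((h s).1 hs).1
  refine isLatticeConvex_of_finite (hfin.subset hsub) fun z hz => (h z).2 ⟨?_, ?_⟩
  · exact hS.2 z (convexHull_mono (Set.image_mono hsub) hz)
  · exact convexHull_subset_of_lt S' α β γ (fun s hs => ((h s).1 hs).2) hz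

theorem IsLatticeConvex.diff_face {S : Set (ℤ × ℤ)} (hS : IsLatticeConvex S)
    (hfin : S.Finite) {v : ℤ × ℤ} {m : ℤ} (hm : ∀ s, s ∈ face v S ↔ s ∈ S ∧ cross v s = m)
    (hmin : ∀ s ∈ S, m ≤ cross v s) : IsLatticeConvex (S \ face v S) := by
  refine hS.inter_halfPlane hfin (-v.2) v.1 m fun s => ?_
  rw [Set.mem_sdiff, hm, show -v.2 * s.1 + v.1 * s.2 = cross v s by simp only [cross]; ring]
  constructor
  · rintro ⟨hs, hn⟩
    exact ⟨hs, lt_of_le_of_ne (hmin s hs) fun e => hn ⟨hs, e.symm⟩⟩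
  · rintro ⟨hs, hlt⟩
    exact ⟨hs, fun e => hlt.ne' e.2⟩

/-- Tilting the supporting line slightly about `x` separates `x` from all other points of `S`. -/
theorem IsLatticeConvex.diff_endpoint {S : Set (ℤ × ℤ)} (hS : IsLatticeConvex S)
    (hfin : S.Finite) {v u : ℤ × ℤ} (hvu : cross v u = 1) {x : ℤ × ℤ}
    (hx : IsEndpoint v (face v S) x) : IsLatticeConvex (S \ {x}) := by
  obtain ⟨B, hB⟩ := (hfin.image fun s => |cross s u - cross x u|).bddAbove
  have hB' : ∀ s ∈ S, |cross s u - cross x u| ≤ B := fun s hs => hB ⟨s, hs, rfl⟩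
  have hadd : ∀ i : ℤ, cross (x + i • v) u = cross x u + i := fun i => by
    have : cross (x + i • v) u = cross x u + i * cross v u := by
      simp only [cross, Prod.fst_add, Prod.snd_add, Prod.smul_fst, Prod.smul_snd, smul_eq_mul]
      ring
    rw [this, hvu, mul_one]
  obtain ⟨ε, hε, hεv⟩ : ∃ ε : ℤ, (ε = 1 ∨ ε = -1) ∧
      ∀ s ∈ face v S, s ≠ x → 0 < ε * (cross s u - cross x u) := by
    rcases hx.2 with h | h
    · refine ⟨1, Or.inl rfl, fun s hs hne => ?_⟩
      obtain ⟨i, rfl⟩ := h s hs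
      have : i ≠ 0 := by rintro rfl; simp at hne
      rw [hadd]; omega
    · refine ⟨-1, Or.inr rfl, fun s hs hne => ?_⟩
      obtain ⟨i, rfl⟩ := h s hs
      have : i ≠ 0 := by rintro rfl; simp at hne
      rw [show x - (i : ℤ) • v = x + (-(i : ℤ)) • v by rw [neg_smul, sub_eq_add_neg], hadd]; omega
  -- The weight `B + 1` exceeds every variation along `v`, so a higher level always wins; on the
  -- bottom line the sign `ε` makes `x` the unique minimum.
  let χ : ℤ × ℤ → ℤ := fun s => (B + 1) * cross v s + ε * cross s u
  refine hS.inter_halfPlane hfin (-(B + 1) * v.2 + ε * u.2) ((B + 1) * v.1 - ε * u.1) (χ x)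
    fun s => ?_
  rw [Set.mem_sdiff, Set.mem_singleton_iff,
    show (-(B + 1) * v.2 + ε * u.2) * s.1 + ((B + 1) * v.1 - ε * u.1) * s.2 = χ s by
      simp only [χ, cross]; ring]
  constructor
  · rintro ⟨hs, hne⟩
    refine ⟨hs, ?_⟩
    have h1 := abs_le.1 (hB' s hs)
    simp only [χ]
    rcases eq_or_lt_of_le (hx.1.2 s hs) with he | hlt
    · have hsf : s ∈ face v S := ⟨hs, fun y hy => he ▸ hx.1.2 y hy⟩
      have := hεv s hsf hne
      rw [he]
      linarith
    · have h2 : B + 1 ≤ (B + 1) * (cross v s - cross v x) := by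
        have h3 : 0 ≤ B := (abs_nonneg _).trans (hB' s hs)
        nlinarith
      rcases hε with rfl | rfl <;> linarith
  · rintro ⟨hs, hlt⟩
    exact ⟨hs, fun e => by rw [e] at hlt; exact lt_irrefl _ hlt⟩

theorem IsLatticeConvex.add_smul_mem {S : Set (ℤ × ℤ)} (hS : IsLatticeConvex S) {v z : ℤ × ℤ}
    {i j : ℤ} (hj : 0 ≤ j) (hji : j ≤ i) (hz : z ∈ S) (hzi : z + i • v ∈ S) : z + j • v ∈ S := by
  rcases eq_or_lt_of_le (hj.trans hji) with h0 | hi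
  · have : j = 0 := by omega
    rwa [this, zero_smul, add_zero]
  have hi' : (0 : ℝ) < i := by exact_mod_cast hi
  have hj' : (0 : ℝ) ≤ j := by exact_mod_cast hj
  have hji' : (j : ℝ) ≤ i := by exact_mod_cast hji
  refine hS.2 _ ?_
  have := (convex_convexHull ℝ (toReal '' S)) (subset_convexHull ℝ _ ⟨z, hz, rfl⟩)
    (subset_convexHull ℝ _ ⟨_, hzi, rfl⟩) (a := 1 - (j : ℝ) / i) (b := (j : ℝ) / i)
    (sub_nonneg.2 ((div_le_one hi').2 hji')) (by positivity) (by ring)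
  convert this using 1
  have hne := hi'.ne'
  ext <;> simp only [toReal, Prod.fst_add, Prod.snd_add, Prod.smul_fst, Prod.smul_snd,
    smul_eq_mul, Int.cast_add, Int.cast_mul] <;> field_simp <;> ring

theorem exists_interval (X : Finset ℤ) (hX : ∀ i ∈ X, ∀ j ∈ X, ∀ k, i ≤ k → k ≤ j → k ∈ X) :
    ∃ a : ℤ, ∀ i, i ∈ X ↔ a ≤ i ∧ i < a + X.card := by
  rcases X.eq_empty_or_nonempty with rfl | hne
  · exact ⟨0, fun i => by simp⟩
  · have : X = Finset.Icc (X.min' hne) (X.max' hne) := by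
      ext i
      rw [Finset.mem_Icc]
      exact ⟨fun hi => ⟨X.min'_le _ hi, X.le_max' _ hi⟩,
        fun hi => hX _ (X.min'_mem hne) _ (X.max'_mem hne) i hi.1 hi.2⟩
    have hle : X.min' hne ≤ X.max' hne := X.min'_le _ (X.max'_mem hne)
    refine ⟨X.min' hne, fun i => ?_⟩
    have hcard : X.card = (X.max' hne + 1 - X.min' hne).toNat := by
      conv_lhs => rw [this]
      exact Int.card_Icc _ _
    conv_lhs => rw [this]
    rw [Finset.mem_Icc, hcard]
    omega

/-- The points of `S` on the line `cross v = t`. -/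
def row (v : ℤ × ℤ) (S : Set (ℤ × ℤ)) (t : ℤ) : Set (ℤ × ℤ) := {z | z ∈ S ∧ cross v z = t}

theorem IsLatticeConvex.exists_row_start {S : Set (ℤ × ℤ)} (hS : IsLatticeConvex S)
    (hfin : S.Finite) {v u : ℤ × ℤ} (hvu : cross v u = 1) :
    ∃ a : ℤ → ℤ, ∀ t i, pt v u i t ∈ S ↔ a t ≤ i ∧ i < a t + (row v S t).ncard := by
  have hrow : ∀ t, (row v S t).Finite := fun t => hfin.subset (Set.sep_subset _ _)
  have hex : ∀ t, ∃ a : ℤ, ∀ i, pt v u i t ∈ S ↔ a ≤ i ∧ i < a + (row v S t).ncard := by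
    intro t
    have hXfin : {i | pt v u i t ∈ S}.Finite := by
      refine hfin.preimage (f := fun i => pt v u i t) fun i _ j _ hij => (pt_injective hvu hij).1
    have himg : row v S t = (fun i => pt v u i t) '' {i | pt v u i t ∈ S} := by
      ext z
      constructor
      · rintro ⟨hz, rfl⟩
        have := eq_pt hvu z
        exact ⟨cross z u, by rwa [Set.mem_ofPred_eq, ← this], this.symm⟩
      · rintro ⟨i, hi, rfl⟩
        exact ⟨hi, cross_pt hvu _ _⟩
    have hcard : (row v S t).ncard = hXfin.toFinset.card := by
      rw [himg, Set.ncard_image_of_injective _ fun i j hij => (pt_injective hvu hij).1,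
        Set.ncard_eq_toFinset_card _ hXfin]
    obtain ⟨a, ha⟩ := exists_interval hXfin.toFinset (by
      intro i hi j hj k hik hkj
      simp only [Set.Finite.mem_toFinset, Set.mem_ofPred_eq] at hi hj ⊢
      have := hS.add_smul_mem (v := v) (z := pt v u i t) (i := j - i) (j := k - i) (by omega)
        (by omega) hi (by rwa [pt_add_smul, add_sub_cancel])
      rwa [pt_add_smul, add_sub_cancel] at this)
    refine ⟨a, fun i => ?_⟩
    rw [hcard, ← ha i]
    simp
  choose a ha using hex
  exact ⟨a, ha⟩

/-- Restriction of words to `S \ {x}` is onto; equal finite cardinalities would make it injective.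
-/
theorem IsGenerated.complexity_lt [Finite A] {η : ℤ × ℤ → A} {S : Set (ℤ × ℤ)} (hS : S.Finite)
    {x : ℤ × ℤ} (h : ¬ IsGenerated η S x) : complexity η (S \ {x}) < complexity η S := by
  refine lt_of_le_of_ne (complexity_mono η Set.sdiff_subset hS) fun heq => h ?_
  unfold complexity at heq
  rw [← image_words η (Set.sdiff_subset : S \ {x} ⊆ S)] at heq
  have hinj := Set.injOn_of_ncard_image_eq heq (finite_words η hS)
  refine isGenerated_of_word_ext fun β₁ h₁ β₂ h₂ hβ => hinj h₁ h₂ ?_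
  funext s
  exact hβ ⟨s, s.2.1⟩ s.2.2

/-! ### Colorings with a period in direction `v` -/

/-- The parallelogram of `k` columns and two lines. -/
def parallelogram (v u : ℤ × ℤ) (k : ℕ) : Set (ℤ × ℤ) :=
  {z | (0 ≤ cross v z ∧ cross v z ≤ 1) ∧ 0 ≤ cross z u ∧ cross z u < k}

theorem cross_pt_right {v u : ℤ × ℤ} (h : cross v u = 1) (i t : ℤ) :
    cross (pt v u i t) u = i :=
  (pt_injective h ((eq_pt h (pt v u i t)).symm)).1

theorem pt_mem_parallelogram {v u : ℤ × ℤ} (h : cross v u = 1) {k : ℕ} {i t : ℤ} :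
    pt v u i t ∈ parallelogram v u k ↔ (0 ≤ t ∧ t ≤ 1) ∧ 0 ≤ i ∧ i < k := by
  unfold parallelogram
  rw [Set.mem_ofPred_eq, cross_pt h, cross_pt_right h]

theorem ncard_line {v u : ℤ × ℤ} (h : cross v u = 1) (k : ℕ) {t : ℤ} (ht : 0 ≤ t ∧ t ≤ 1) :
    {z | z ∈ parallelogram v u k ∧ cross v z = t}.ncard = k := by
  have : {z | z ∈ parallelogram v u k ∧ cross v z = t} =
      (fun i : ℕ => pt v u i t) '' (Finset.range k : Set ℕ) := by
    ext z
    constructor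
    · rintro ⟨⟨-, hz1, hz2⟩, rfl⟩
      refine ⟨(cross z u).toNat, by simp only [Finset.coe_range, Set.mem_Iio]; omega, ?_⟩
      simp only [Int.toNat_of_nonneg hz1]
      exact (eq_pt h z).symm
    · rintro ⟨i, hi, rfl⟩
      simp only [Finset.coe_range, Set.mem_Iio] at hi
      exact ⟨(pt_mem_parallelogram h).2 ⟨ht, by omega, by omega⟩, cross_pt h _ _⟩
  rw [this, Set.ncard_image_of_injective, Set.ncard_coe_finset, Finset.card_range]
  intro i j hij
  have := (pt_injective h hij).1
  omega

theorem finite_parallelogram {v u : ℤ × ℤ} (h : cross v u = 1) (k : ℕ) :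
    (parallelogram v u k).Finite := by
  refine ((Set.finite_Icc ((0 : ℤ), (0 : ℤ)) ((k : ℤ), 1)).image fun x => pt v u x.1 x.2).subset ?_
  rintro z ⟨⟨h1, h2⟩, h3, h4⟩
  exact ⟨(cross z u, cross v z), ⟨⟨h3, h1⟩, ⟨h4.le, h2⟩⟩, (eq_pt h z).symm⟩

theorem isLatticeConvex_parallelogram {v u : ℤ × ℤ} (h : cross v u = 1) (k : ℕ) :
    IsLatticeConvex (parallelogram v u k) := by
  refine isLatticeConvex_of_finite (finite_parallelogram h k) fun z hz => ?_
  have h1 := convexHull_subset_of_lt _ (-v.2) v.1 (-1) (fun s hs => by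
    have := hs.1.1; simp only [cross] at this; linarith) hz
  have h2 := convexHull_subset_of_lt _ v.2 (-v.1) (-2) (fun s hs => by
    have := hs.1.2; simp only [cross] at this; linarith) hz
  have h3 := convexHull_subset_of_lt _ u.2 (-u.1) (-1) (fun s hs => by
    have := hs.2.1; simp only [cross] at this; linarith) hz
  have h4 := convexHull_subset_of_lt _ (-u.2) u.1 (-k) (fun s hs => by
    have := hs.2.2; simp only [cross] at this; linarith) hz
  refine ⟨⟨?_, ?_⟩, ?_, ?_⟩ <;> simp only [cross] <;> linarith

/-- The case of a coloring with a period in direction `v`. -/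
theorem exists_balanced_of_periodic [Finite A] {η : ℤ × ℤ → A} {v u : ℤ × ℤ} (hvu : cross v u = 1)
    {p : ℕ} (hp1 : 1 ≤ p) (hp : ∀ z, η (z + (p : ℤ) • v) = η z) {H : Set (ℤ × ℤ)}
    (hH : IsHalfPlane v H) :
    ∃ S : Set (ℤ × ℤ), IsBalanced η v S ∧ 2 ≤ (face v S).ncard ∧
      ∀ f : ℤ × ℤ → A, IsHalfPlaneAmbiguous η v S H f →
        (∃ p : ℤ, PeriodicOn f Set.univ (p • v)) ∧
        HasPeriodAtMost f (border v (S \ face v S) H) v ((face v S).ncard - 1) ∧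
        ∀ B : Set (ℤ × ℤ), IsStrip v B → diam v B = diam v (S \ face v S) →
          HasPeriodAtMost f B v (2 * (face v S).ncard - 2) := by
  have hmod : ∀ (x : ℤ × ℤ) (i t : ℤ), η (pt v u i t + x) = η (pt v u (i % p) t + x) := by
    intro x i t
    have := apply_add_mul_of_periodic (fun i => η (pt v u i t + x)) (q := (p : ℤ))
      (fun i => by
        rw [← pt_add_smul, add_right_comm]; exact hp _) (i / p) (i % p)
    rw [← this]
    congr 3
    rw [mul_comm, Int.emod_add_mul_ediv]
  -- The term `2 * p` gives every point of `S` a companion in `S` at distance `p` along `v`; the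
  -- other terms make `k` exceed the number of colorings, which is bounded by that of `p` columns.
  let k := 2 * p + complexity η (parallelogram v u p) + 1
  let S := parallelogram v u k
  have hfin : S.Finite := finite_parallelogram hvu k
  have hlt : complexity η S < k := by
    have hsub : parallelogram v u p ⊆ S := fun z hz => ⟨hz.1, hz.2.1, by have := hz.2.2; omega⟩
    have hle : complexity η S ≤ complexity η (parallelogram v u p) := by
      unfold complexity
      rw [← image_words η hsub, Set.InjOn.ncard_image]
      rintro _ ⟨x, rfl⟩ _ ⟨y, rfl⟩ hxy
      funext s
      have hs := eq_pt hvu (s : ℤ × ℤ)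
      have hr1 := Int.emod_nonneg (cross (s : ℤ × ℤ) u) (show (p : ℤ) ≠ 0 by omega)
      have hr2 := Int.emod_lt_of_pos (cross (s : ℤ × ℤ) u) (show (0 : ℤ) < p by omega)
      have := congrFun hxy ⟨pt v u (cross (s : ℤ × ℤ) u % p) (cross v s),
        (pt_mem_parallelogram hvu).2 ⟨s.2.1, hr1, hr2⟩⟩
      simp only
      rw [hs, hmod x, hmod y]
      exact this
    omega
  have hface : ∀ s, s ∈ face v S ↔ s ∈ S ∧ cross v s = 0 := by
    intro s
    constructor
    · rintro ⟨hs, hmin⟩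
      refine ⟨hs, le_antisymm ?_ hs.1.1⟩
      have := hmin (pt v u 0 0) ((pt_mem_parallelogram hvu).2 ⟨by omega, by omega, by omega⟩)
      rwa [cross_pt hvu] at this
    · rintro ⟨hs, h0⟩
      exact ⟨hs, fun y hy => h0 ▸ hy.1.1⟩
  have hfcard : (face v S).ncard = k := by
    rw [← ncard_line hvu k (t := 0) (by omega)]
    congr 1
    ext s
    exact hface s
  have hgen : ∀ x ∈ S, IsGenerated η S x := by
    intro x hx
    obtain ⟨y, hy, hyx, hηy⟩ : ∃ y ∈ S, y ≠ x ∧ ∀ w, η (x + w) = η (y + w) := by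
      have hxe := eq_pt hvu x
      have hx1 := hx.2.1
      have hx2 := hx.2.2
      by_cases hc : cross x u + p < k
      · refine ⟨pt v u (cross x u + p) (cross v x),
          (pt_mem_parallelogram hvu).2 ⟨hx.1, by omega, hc⟩, fun e => ?_, fun w => ?_⟩
        · have := cross_pt_right hvu (cross x u + p) (cross v x)
          rw [e] at this; omega
        · rw [← pt_add_smul, ← hxe, add_right_comm]; exact (hp _).symm
      · refine ⟨pt v u (cross x u - p) (cross v x),
          (pt_mem_parallelogram hvu).2 ⟨hx.1, by omega, by omega⟩, fun e => ?_, fun w => ?_⟩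
        · have := cross_pt_right hvu (cross x u - p) (cross v x)
          rw [e] at this; omega
        · rw [← hp (pt v u (cross x u - p) (cross v x) + w), add_right_comm, pt_add_smul,
            sub_add_cancel, ← hxe]
    refine isGenerated_of_word_ext ?_
    rintro _ ⟨w₁, rfl⟩ _ ⟨w₂, rfl⟩ hβ
    funext s
    by_cases hs : (s : ℤ × ℤ) = x
    · simp only [hs, hηy]
      exact hβ ⟨y, hy⟩ hyx
    · exact hβ s hs
  have hScard : S.ncard = (S \ face v S).ncard + k := by
    rw [← hfcard]
    exact (Set.ncard_sdiff_add_ncard_of_subset (fun s hs => hs.1) hfin).symm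
  have hbal : IsBalanced η v S := by
    refine ⟨hfin, isLatticeConvex_parallelogram hvu k, ⟨pt v u 0 1, ?_⟩, ?_, ?_, ?_⟩
    · rw [Set.mem_sdiff, hface, cross_pt hvu]
      exact ⟨(pt_mem_parallelogram hvu).2 ⟨by omega, by omega, by omega⟩, by omega⟩
    · rintro t ⟨z, hz, rfl⟩
      rw [hfcard, ncard_line hvu k hz.1]
      omega
    · exact fun x hx => hgen x hx.1.1
    · unfold discrepancy
      rw [hScard]
      push_cast
      omega
  refine ⟨S, hbal, by omega, fun f hf => ?_⟩
  -- Each line of `S` contains two points at distance `p`, so the words of shape `S` force the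
  -- period of `η` upon `f`.
  have hfp : ∀ z, f (z + (p : ℤ) • v) = f z := by
    intro z
    obtain ⟨y, hy⟩ := wordAt_mem_of_mem_sft hf.1 z
    have h1 := congrFun hy ⟨pt v u 0 0, (pt_mem_parallelogram hvu).2 ⟨by omega, by omega, by omega⟩⟩
    have h2 := congrFun hy ⟨pt v u p 0, (pt_mem_parallelogram hvu).2 ⟨by omega, by omega, by omega⟩⟩
    simp only [wordAt] at h1 h2
    rw [hmod, Int.emod_self, h1] at h2
    simpa [pt, add_comm] using h2.symm
  have hpv : (p : ℤ) • v ≠ 0 := smul_ne_zero (by omega) (ne_zero_of_cross hvu)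
  refine ⟨⟨p, hpv, fun z _ => ⟨trivial, hfp z⟩⟩, ?_, ?_⟩
  · obtain ⟨c, rfl⟩ := hH
    exact ⟨p, hp1, by omega, hpv, fun z hz => ⟨border_add_smul v _ c p hz, hfp z⟩⟩
  · rintro B ⟨b₁, b₂, -, rfl⟩ -
    refine ⟨p, hp1, by omega, hpv, fun z hz => ⟨?_, hfp z⟩⟩
    rw [Set.mem_ofPred_eq, cross_add_smul_self]
    exact hz

/-- Morse–Hedlund applies to every line parallel to `v`; the periods may differ but all divide `k
!`. -/
theorem periodic_of_complexity_le [Finite A] {η : ℤ × ℤ → A} {v u : ℤ × ℤ} (hvu : cross v u = 1)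
    {S : Set (ℤ × ℤ)} (i₀ t : ℤ) (k : ℕ)
    (hS : ∀ s, s ∈ S ↔ ∃ j : ℕ, j < k ∧ s = pt v u (i₀ + j) t) (hc : complexity η S ≤ k) :
    ∃ p : ℕ, 1 ≤ p ∧ ∀ z, η (z + (p : ℤ) • v) = η z := by
  have hfin : S.Finite := by
    refine ((Finset.range k).finite_toSet.image fun j : ℕ => pt v u (i₀ + j) t).subset ?_
    intro s hs
    obtain ⟨j, hj, rfl⟩ := (hS s).1 hs
    exact ⟨j, by simpa using hj, rfl⟩
  have hline : ∀ t', ∃ p : ℕ, 1 ≤ p ∧ p ≤ k ∧ ∀ i, η (pt v u (i + p) t') = η (pt v u i t') := by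
    intro t'
    let κ : ℤ → (S → A) := fun i => wordAt η S (pt v u (i - i₀) (t' - t))
    have hr : Set.range κ ⊆ words η S := by
      rintro _ ⟨i, rfl⟩; exact wordAt_mem_words _ _ _
    refine (morse_hedlund (fun i => η (pt v u i t')) k κ ((finite_words η hfin).subset hr)
      ((Set.ncard_le_ncard hr (finite_words η hfin)).trans hc) fun i j hij l hl => ?_).2
    have := congrFun hij ⟨_, (hS _).2 ⟨l, hl, rfl⟩⟩
    simp only [κ, wordAt, pt_add] at this
    convert this using 3 <;> ring
  refine ⟨Nat.factorial k, Nat.factorial_pos k, fun z => ?_⟩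
  obtain ⟨p, hp1, hp2, hp⟩ := hline (cross v z)
  obtain ⟨c, hc⟩ := Nat.dvd_factorial hp1 hp2
  have := apply_add_mul_of_periodic (fun i => η (pt v u i (cross v z))) hp c (cross z u)
  simp only [← pt_add_smul] at this
  rw [← eq_pt hvu z] at this
  rw [hc, ← this]
  congr 3; push_cast; ring

/-- In coordinates sending `v` to `(0, -1)` and `u` to `(1, 0)`, move the unique lowest point `x` to
`(-1, 0)`. The rest of `S` then lies in a large enough box and determines the color at `x`. -/
theorem isOneSidedExpansive_of_isGenerated {η : ℤ × ℤ → A} {v u : ℤ × ℤ} (hvu : cross v u = 1)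
    {S : Set (ℤ × ℤ)} (hfin : S.Finite) {x : ℤ × ℤ} (hx : x ∈ S) (hgen : IsGenerated η S x)
    (hmin : ∀ s ∈ S, s ≠ x → cross v x < cross v s) : IsOneSidedExpansive η v := by
  let M : Matrix.SpecialLinearGroup (Fin 2) ℤ := ⟨!![u.1, -v.1; u.2, -v.2], by
    rw [Matrix.det_fin_two_of]; simp only [cross] at hvu; linarith⟩
  have hM : ∀ z, slAct M z = pt v u (-z.2) z.1 := by
    intro z
    ext <;> simp [slAct, M, pt] <;> ring
  obtain ⟨B, hB⟩ := (hfin.image fun s => |cross s u - cross x u| + |cross v s - cross v x|).bddAbove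
  have hB' : ∀ s ∈ S, |cross s u - cross x u| + |cross v s - cross v x| ≤ B :=
    fun s hs => hB ⟨s, hs, rfl⟩
  have hB0 : 0 ≤ B := by simpa using hB' x hx
  refine ⟨B.toNat, B.toNat, M, by rw [hM]; simp [pt], ?_⟩
  rintro _ ⟨y, rfl⟩
  refine ⟨fun z => (η ∘ slAct M) (z + y), ⟨⟨y, rfl⟩, fun t => rfl⟩, ?_⟩
  rintro _ ⟨⟨y', rfl⟩, hy'⟩
  -- the translate of `S` that sends `x` to the image of `(-1, 0)`
  have hbox : ∀ z ∈ box B.toNat B.toNat, η (slAct M (z + y')) = η (slAct M (z + y)) :=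
    fun z hz => hy' ⟨z, hz⟩
  let q : ℤ × ℤ → ℤ × ℤ := fun s => (-1 + (cross v s - cross v x), -(cross s u - cross x u))
  have hq : ∀ s w, slAct M (q s + w) = s + (pt v u (-cross x u) (-1 - cross v x) + slAct M w) := by
    intro s w
    have hs := eq_pt hvu s
    conv_rhs => rw [hs]
    rw [hM, hM, pt_add, pt_add]
    simp only [q, Prod.fst_add, Prod.snd_add]
    congr 1 <;> ring
  have hoff : ∀ s ∈ S, s ≠ x → q s ∈ box B.toNat B.toNat := by
    intro s hs hne
    have h1 := hB' s hs
    have h2 := hmin s hs hne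
    have h3 := abs_nonneg (cross v s - cross v x)
    have h4 := abs_nonneg (cross s u - cross x u)
    have h5 := abs_le.1 (show |cross s u - cross x u| ≤ B by linarith)
    have h6 := abs_le.1 (show |cross v s - cross v x| ≤ B by linarith)
    simp only [box, q, Set.mem_ofPred_eq, Int.toNat_of_nonneg hB0]
    refine ⟨?_, ?_, ?_, ?_⟩ <;> linarith
  have hηS : η ∈ sft η S := fun β hβ => hβ
  have key := hgen.eq_of_eq hx hηS hηS
    (pt v u (-cross x u) (-1 - cross v x) + slAct M y')
    (pt v u (-cross x u) (-1 - cross v x) + slAct M y) (fun s hs hne => by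
      rw [← hq, ← hq]
      exact hbox _ (hoff s hs hne))
  rw [← hq, ← hq] at key
  funext z
  obtain ⟨z, hz | hz⟩ := z
  · exact hbox z hz
  · have hz' : z = q x := by
      rw [Set.mem_singleton_iff.1 hz]; simp [q]
    subst hz'
    exact key

/-! ### The rectangle -/

theorem finite_rect (n k : ℕ) : (rect n k).Finite := by
  refine (Set.finite_Icc ((0 : ℤ), (0 : ℤ)) ((n : ℤ), (k : ℤ))).subset ?_
  rintro z ⟨h1, h2, h3, h4⟩
  exact ⟨⟨h1, h3⟩, ⟨h2.le, h4.le⟩⟩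

theorem ncard_rect (n k : ℕ) : (rect n k).ncard = n * k := by
  have : rect n k = (Finset.Ico (0 : ℤ) n ×ˢ Finset.Ico (0 : ℤ) k : Finset (ℤ × ℤ)) := by
    ext z
    simp only [rect, Set.mem_ofPred_eq, Finset.coe_product, Finset.coe_Ico, Set.mem_prod,
      Set.mem_Ico]
    tauto
  rw [this, Set.ncard_coe_finset, Finset.card_product]
  simp

theorem isLatticeConvex_rect (n k : ℕ) : IsLatticeConvex (rect n k) := by
  refine isLatticeConvex_of_finite (finite_rect n k) fun z hz => ?_
  have h1 := convexHull_subset_of_lt _ 1 0 (-1) (fun s hs => by have := hs.1; linarith) hz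
  have h2 := convexHull_subset_of_lt _ (-1) 0 (-n) (fun s hs => by have := hs.2.1; linarith) hz
  have h3 := convexHull_subset_of_lt _ 0 1 (-1) (fun s hs => by have := hs.2.2.1; linarith) hz
  have h4 := convexHull_subset_of_lt _ 0 (-1) (-k) (fun s hs => by have := hs.2.2.2; linarith) hz
  refine ⟨?_, ?_, ?_, ?_⟩ <;> linarith

/-- The corner of the rectangle opposite to the origin. -/
def corner (n k : ℕ) : ℤ × ℤ := ((n : ℤ) - 1, (k : ℤ) - 1)

theorem mem_rect_iff {n k : ℕ} {z : ℤ × ℤ} :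
    z ∈ rect n k ↔ (0 ≤ z.1 ∧ 0 ≤ (corner n k - z).1) ∧ (0 ≤ z.2 ∧ 0 ≤ (corner n k - z).2) := by
  simp only [rect, corner, Set.mem_ofPred_eq, Prod.fst_sub, Prod.snd_sub]
  omega

theorem corner_sub_mem {n k : ℕ} {z : ℤ × ℤ} (hz : z ∈ rect n k) : corner n k - z ∈ rect n k := by
  rw [mem_rect_iff] at hz ⊢
  rw [sub_sub_cancel]
  tauto

/-- A linear function nonnegative at the four vertices of a parallelogram is nonnegative inside.
Here `f` is its increment along one side direction, and all is scaled by `E` to stay in the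
integers. -/
theorem nonneg_of_parallelogram {E δ L w P Q f : ℤ} (hδ : 0 ≤ δ) (hδE : δ ≤ E) (hP : 0 ≤ P)
    (hP' : 0 ≤ P + L * f) (hQ : 0 ≤ Q) (hQ' : 0 ≤ Q + L * f) (hw : 0 ≤ w) (hwL : w ≤ E * L) :
    0 ≤ (E - δ) * P + δ * Q + w * f := by
  have h1 := mul_nonneg (sub_nonneg.2 hδE) hP
  have h2 := mul_nonneg hδ hQ
  have h3 := mul_nonneg (sub_nonneg.2 hδE) hP'
  have h4 := mul_nonneg hδ hQ'
  rcases le_total 0 f with hf | hf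
  · have := mul_nonneg hw hf
    linarith
  · have := mul_le_mul_of_nonpos_right hwL hf
    nlinarith

/-- Moving from a line of level `t` towards the centre of the rectangle, the number of points on
the line drops by at most one. -/
theorem ncard_row_rect_le {v u : ℤ × ℤ} (hvu : cross v u = 1) (n k : ℕ) {t t' : ℤ} (htt' : t ≤ t')
    (ht' : 2 * t' ≤ cross v (corner n k)) :
    (row v (rect n k) t).ncard ≤ (row v (rect n k) t').ncard + 1 := by
  obtain ⟨a, ha⟩ := (isLatticeConvex_rect n k).exists_row_start (finite_rect n k) hvu
  rcases eq_or_lt_of_le htt' with rfl | hlt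
  · omega
  set N := (row v (rect n k) t).ncard with hN
  by_cases hN2 : N ≤ 1
  · omega
  let C := cross v (corner n k)
  let E := C - 2 * t
  let δ := t' - t
  let L : ℤ := N - 1
  have hE : 0 < E := by simp only [E, C]; omega
  let p := pt v u (a t) t
  have hp : p ∈ rect n k := (ha t _).2 ⟨le_rfl, by omega⟩
  have hpL : p + L • v ∈ rect n k := by
    rw [pt_add_smul]
    exact (ha t _).2 ⟨by simp only [L]; omega, by simp only [L]; omega⟩
  -- The segment at level `t` and its reflection in the centre span a parallelogram in the
  -- rectangle. Its section at level `t'` has length `L = N - 1` in units of `v`, hence contains at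
  -- least `N - 1` integer points.
  let q := corner n k - (p + L • v)
  have hq : q ∈ rect n k := corner_sub_mem hpL
  have hqL : q + L • v ∈ rect n k := by
    have := corner_sub_mem hp
    rwa [show q + L • v = corner n k - p by simp only [q]; abel]
  let B := (E - δ) * cross p u + δ * cross q u
  -- the first point on the line of level `t'` to the right of the parallelogram's left side
  let x := -((-B) / E)
  have hx1 : B ≤ E * x := by
    have := Int.ediv_mul_le (-B) hE.ne'
    simp only [x]; linarith
  have hx2 : E * x < B + E := by
    have := Int.lt_ediv_add_one_mul_self (-B) hE
    simp only [x]; linarith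
  have hcp : cross v p = t := cross_pt hvu _ _
  have hcq : cross v q = C - t := by
    simp only [q]; rw [cross_sub, cross_add_smul_self, hcp]
  have hmem : ∀ j : ℕ, j + 1 < N → pt v u (x + j) t' ∈ rect n k := by
    intro j hj
    let w := E * (x + j) - B
    have hw : 0 ≤ w := by simp only [w]; nlinarith
    have hwL : w ≤ E * L := by
      have : E * ((j : ℤ) + 1) ≤ E * L := mul_le_mul_of_nonneg_left (by simp only [L]; omega) hE.le
      simp only [w]; linarith
    have hsum : E • pt v u (x + j) t' = (E - δ) • p + δ • q + w • v := by
      have e1 : p = pt v u (cross p u) t := by rw [← hcp]; exact eq_pt hvu p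
      have e2 : q = pt v u (cross q u) (C - t) := by rw [← hcq]; exact eq_pt hvu q
      conv_rhs => rw [e1, e2]
      ext <;> simp only [pt, Prod.fst_add, Prod.snd_add, Prod.smul_fst, Prod.smul_snd,
        smul_eq_mul, w, B, E, δ] <;> ring
    have hs1 := congrArg Prod.fst hsum
    have hs2 := congrArg Prod.snd hsum
    simp only [Prod.fst_add, Prod.snd_add, Prod.smul_fst, Prod.smul_snd, smul_eq_mul] at hs1 hs2
    have hδ : 0 ≤ δ := by simp only [δ]; omega
    have hδE : δ ≤ E := by simp only [δ, E, C]; omega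
    rw [mem_rect_iff] at hp hpL hq hqL ⊢
    simp only [Prod.fst_add, Prod.snd_add, Prod.fst_sub, Prod.snd_sub, Prod.smul_fst,
      Prod.smul_snd, smul_eq_mul] at hp hpL hq hqL ⊢
    refine ⟨⟨?_, ?_⟩, ?_, ?_⟩ <;> refine nonneg_of_mul_nonneg_right ?_ hE
    · rw [hs1]
      exact nonneg_of_parallelogram hδ hδE hp.1.1 hpL.1.1 hq.1.1 hqL.1.1 hw hwL
    · have := nonneg_of_parallelogram (f := -v.1) hδ hδE hp.1.2 (by linarith [hpL.1.2])
        hq.1.2 (by linarith [hqL.1.2]) hw hwL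
      rw [mul_sub, hs1]; linarith
    · rw [hs2]
      exact nonneg_of_parallelogram hδ hδE hp.2.1 hpL.2.1 hq.2.1 hqL.2.1 hw hwL
    · have := nonneg_of_parallelogram (f := -v.2) hδ hδE hp.2.2 (by linarith [hpL.2.2])
        hq.2.2 (by linarith [hqL.2.2]) hw hwL
      rw [mul_sub, hs2]; linarith
  have h0 := (ha t' _).1 (hmem 0 (by omega))
  have h1 := (ha t' _).1 (hmem (N - 2) (by omega))
  push_cast at h0 h1
  omega

/-- The points of the rectangle on the lines up to its centre. -/
def halfRect (v : ℤ × ℤ) (n k : ℕ) : Set (ℤ × ℤ) :=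
  {z | z ∈ rect n k ∧ 2 * cross v z ≤ cross v (corner n k)}

/-- Of two points exchanged by reflection in the centre, at least one lies in the half rectangle. -/
theorem le_two_mul_ncard_halfRect (v : ℤ × ℤ) (n k : ℕ) : n * k ≤ 2 * (halfRect v n k).ncard := by
  have hsub : rect n k ⊆ halfRect v n k ∪ (fun z => corner n k - z) '' halfRect v n k := by
    intro z hz
    by_cases h : 2 * cross v z ≤ cross v (corner n k)
    · exact Or.inl ⟨hz, h⟩
    · refine Or.inr ⟨corner n k - z, ⟨corner_sub_mem hz, ?_⟩, sub_sub_cancel _ _⟩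
      rw [cross_sub]; omega
  have hf : (halfRect v n k).Finite := (finite_rect n k).subset (Set.sep_subset _ _)
  have h1 := Set.ncard_le_ncard hsub (hf.union (hf.image _))
  have h2 := Set.ncard_union_le (halfRect v n k) ((fun z => corner n k - z) '' halfRect v n k)
  have h3 := Set.ncard_image_le hf (f := fun z => corner n k - z)
  rw [ncard_rect] at h1
  omega

/-! ### Balanced sets -/

/-- Finite lattice convex sets with at most as many `η`-colorings as points and with line lengths
that are almost nondecreasing up to the level `C / 2`. -/
structure IsCandidate (η : ℤ × ℤ → A) (v : ℤ × ℤ) (C : ℤ) (S : Set (ℤ × ℤ)) : Prop where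
  nonempty : S.Nonempty
  finite : S.Finite
  convex : IsLatticeConvex S
  level_le : ∀ s ∈ S, 2 * cross v s ≤ C
  rows : ∀ t t', t ≤ t' → 2 * t' ≤ C → (row v S t).ncard ≤ (row v S t').ncard + 1
  complexity_le : complexity η S ≤ S.ncard

theorem isCandidate_halfRect [Finite A] (η : ℤ × ℤ → A) {v u : ℤ × ℤ} (hvu : cross v u = 1)
    {n k : ℕ} (hP : 2 * complexity η (rect n k) ≤ n * k) :
    IsCandidate η v (cross v (corner n k)) (halfRect v n k) := by
  have hsub : halfRect v n k ⊆ rect n k := Set.sep_subset _ _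
  have hpos : 0 < complexity η (rect n k) :=
    (Set.ncard_pos (finite_words η (finite_rect n k))).2 ⟨_, wordAt_mem_words η _ 0⟩
  have hcard := le_two_mul_ncard_halfRect v n k
  have hfin := (finite_rect n k).subset hsub
  have hrow : ∀ t, 2 * t ≤ cross v (corner n k) →
      row v (halfRect v n k) t = row v (rect n k) t := by
    intro t ht
    ext z
    constructor
    · rintro ⟨hz, hzt⟩; exact ⟨hz.1, hzt⟩
    · rintro ⟨hz, rfl⟩; exact ⟨⟨hz, ht⟩, rfl⟩
  refine ⟨(Set.ncard_pos hfin).1 (by omega), hfin, ?_, fun s hs => hs.2, ?_, ?_⟩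
  · refine (isLatticeConvex_rect n k).inter_halfPlane (finite_rect n k) (2 * v.2) (-2 * v.1)
      (-cross v (corner n k) - 1) fun s => ?_
    have : 2 * v.2 * s.1 + -2 * v.1 * s.2 = -(2 * cross v s) := by simp only [cross]; ring
    rw [this]
    exact and_congr_right fun _ => by omega
  · intro t t' h1 h2
    rw [hrow t (by omega), hrow t' h2]
    exact ncard_row_rect_le hvu n k h1 h2
  · have := complexity_mono η hsub (finite_rect n k)
    omega

theorem IsCandidate.exists_minimal {η : ℤ × ℤ → A} {v : ℤ × ℤ} {C : ℤ} {S₀ : Set (ℤ × ℤ)}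
    (h : IsCandidate η v C S₀) :
    ∃ S, IsCandidate η v C S ∧ ∀ S', IsCandidate η v C S' → S.ncard ≤ S'.ncard := by
  classical
  have hex : ∃ N, ∃ S, IsCandidate η v C S ∧ S.ncard = N := ⟨_, S₀, h, rfl⟩
  obtain ⟨S, hS, hN⟩ := Nat.find_spec hex
  exact ⟨S, hS, fun S' hS' => hN ▸ Nat.find_min' hex ⟨S', hS', rfl⟩⟩

/-- Removing points of the bottom line preserves the condition on the lengths of the lines. -/
theorem IsCandidate.rows_of_subset {η : ℤ × ℤ → A} {v : ℤ × ℤ} {C : ℤ} {S S' : Set (ℤ × ℤ)}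
    (h : IsCandidate η v C S) (hsub : S' ⊆ S) (hdiff : ∀ s ∈ S, s ∉ S' → s ∈ face v S) (t t' : ℤ)
    (htt' : t ≤ t') (ht' : 2 * t' ≤ C) : (row v S' t).ncard ≤ (row v S' t').ncard + 1 := by
  have hmono : (row v S' t).ncard ≤ (row v S t).ncard :=
    Set.ncard_le_ncard (fun z hz => ⟨hsub hz.1, hz.2⟩) (h.finite.subset (Set.sep_subset _ _))
  rcases eq_or_lt_of_le htt' with rfl | hlt
  · omega
  rcases (row v S' t).eq_empty_or_nonempty with he | ⟨z, hz, rfl⟩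
  · rw [he]; simp
  -- A point of `S'` at the lower level `t` shows that level `t'` lies above the bottom line of `S`,
  -- so nothing was removed from it.
  · have : row v S' t' = row v S t' := by
      ext y
      constructor
      · rintro ⟨hy, hyt⟩; exact ⟨hsub hy, hyt⟩
      · rintro ⟨hy, rfl⟩
        refine ⟨by_contra fun hn => ?_, rfl⟩
        have := (hdiff y hy hn).2 z (hsub hz)
        omega
    rw [this]
    exact hmono.trans (h.rows _ _ htt' ht')

/-- Minimal candidates are balanced and layered, unless `η` is periodic in direction `v`. -/
theorem IsCandidate.exists_isLayered [Finite A] {η : ℤ × ℤ → A} {v u : ℤ × ℤ}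
    (hvu : cross v u = 1) (hne : ¬ IsOneSidedExpansive η v)
    (hper : ¬ ∃ p : ℕ, 1 ≤ p ∧ ∀ z, η (z + (p : ℤ) • v) = η z) {C : ℤ} {S : Set (ℤ × ℤ)}
    (hS : IsCandidate η v C S) (hmin : ∀ S', IsCandidate η v C S' → S.ncard ≤ S'.ncard) :
    IsBalanced η v S ∧ ∃ m D W a, IsLayered η v u S m D W a := by
  obtain ⟨a, ha⟩ := hS.convex.exists_row_start hS.finite hvu
  obtain ⟨s₀, hs₀, hs₀min⟩ := Set.exists_min_image S (cross v) hS.finite hS.nonempty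
  obtain ⟨s₁, hs₁, hs₁max⟩ := Set.exists_max_image S (cross v) hS.finite hS.nonempty
  set m := cross v s₀ with hm
  let D := (cross v s₁ - m).toNat
  have hD : (D : ℤ) = cross v s₁ - m := Int.toNat_of_nonneg (sub_nonneg.2 (hs₀min s₁ hs₁))
  have hface : ∀ s, s ∈ face v S ↔ s ∈ S ∧ cross v s = m := fun s =>
    ⟨fun h => ⟨h.1, le_antisymm (h.2 s₀ hs₀) (hs₀min s h.1)⟩,
      fun h => ⟨h.1, fun y hy => h.2 ▸ hs₀min y hy⟩⟩
  have hrow : row v S m = face v S := by ext s; exact (hface s).symm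
  set W := (face v S).ncard with hW
  have hfacefin : (face v S).Finite := hS.finite.subset fun s hs => hs.1
  have hWpos : 0 < W := (Set.ncard_pos hfacefin).2 ⟨s₀, (hface s₀).2 ⟨hs₀, rfl⟩⟩
  have hbot : ∀ i, pt v u i m ∈ S ↔ a m ≤ i ∧ i < a m + W := fun i => by rw [ha, hrow]
  have hbottom : ∀ s ∈ S, cross v s = m → ∃ k : ℕ, k < W ∧ s = pt v u (a m + k) m := by
    intro s hs hsm
    have he := eq_pt hvu s
    rw [hsm] at he
    have hb := (hbot (cross s u)).1 (he ▸ hs)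
    refine ⟨(cross s u - a m).toNat, by omega, ?_⟩
    rw [Int.toNat_of_nonneg (by omega), add_sub_cancel]
    exact he
  have hbottom_mem : ∀ k : ℕ, k < W → pt v u (a m + k) m ∈ S := fun k hk =>
    (hbot _).2 ⟨by omega, by omega⟩
  have hcardW : (S \ face v S).ncard + W = S.ncard :=
    Set.ncard_sdiff_add_ncard_of_subset (fun s hs => hs.1) hS.finite
  -- A one-line candidate has at most as many colorings as consecutive points, which makes `η`
  -- periodic.
  have hdiff_ne : (S \ face v S).Nonempty := by
    by_contra hcon
    rw [Set.not_nonempty_iff_eq_empty] at hcon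
    rw [hcon, Set.ncard_empty, zero_add] at hcardW
    refine hper (periodic_of_complexity_le hvu (a m) m W (S := S) (fun s => ⟨fun hs => ?_, ?_⟩)
      (by rw [hcardW]; exact hS.complexity_le))
    · have : s ∈ face v S := by
        by_contra hn
        have : s ∈ S \ face v S := ⟨hs, hn⟩
        rw [hcon] at this; exact this
      exact hbottom s hs ((hface s).1 this).2
    · rintro ⟨k, hk, rfl⟩; exact hbottom_mem k hk
  -- Removing an endpoint that is not generated would lower the complexity along with the
  -- cardinality and leave a smaller candidate.
  have hgen : ∀ x, IsEndpoint v (face v S) x → IsGenerated η S x := by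
    intro x hx
    by_contra hn
    have hlt := IsGenerated.complexity_lt hS.finite hn
    have hxS : x ∈ S := hx.1.1
    have hcard := Set.ncard_sdiff_singleton_add_one hxS hS.finite
    have := hmin (S \ {x}) ⟨hdiff_ne.mono fun s hs => ⟨hs.1, fun e => hs.2 (by
        rw [Set.mem_singleton_iff.1 e]; exact hx.1)⟩, hS.finite.subset Set.sdiff_subset,
      hS.convex.diff_endpoint hS.finite hvu hx, fun s hs => hS.level_le s hs.1,
      hS.rows_of_subset Set.sdiff_subset fun s hs hn => by
        have : s = x := by by_contra h; exact hn ⟨hs, h⟩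
        rw [this]; exact hx.1,
      by have := hS.complexity_le; omega⟩
    omega
  have hcomp : (S \ face v S).ncard < complexity η (S \ face v S) := by
    by_contra hn
    have := hmin (S \ face v S) ⟨hdiff_ne, hS.finite.subset Set.sdiff_subset,
      hS.convex.diff_face hS.finite hface hs₀min, fun s hs => hS.level_le s hs.1,
      hS.rows_of_subset Set.sdiff_subset fun s hs hn => by_contra fun h => hn ⟨hs, h⟩,
      not_lt.1 hn⟩
    omega
  have hrows : ∀ t, m ≤ t → t ≤ m + D → W ≤ (row v S t).ncard + 1 := by
    intro t h1 h2
    have := hS.rows m t h1 (by have := hS.level_le s₁ hs₁; omega)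
    rwa [hrow] at this
  have hleft : IsEndpoint v (face v S) (pt v u (a m) m) := by
    refine ⟨(hface _).2 ⟨by simpa using hbottom_mem 0 hWpos, cross_pt hvu _ _⟩,
      Or.inl fun y hy => ?_⟩
    obtain ⟨hy, hym⟩ := (hface y).1 hy
    obtain ⟨k, -, rfl⟩ := hbottom y hy hym
    exact ⟨k, (pt_add_smul _ _ _ _ _).symm⟩
  have hright : IsEndpoint v (face v S) (pt v u (a m + (W - 1 : ℕ)) m) := by
    refine ⟨(hface _).2 ⟨hbottom_mem (W - 1) (by omega), cross_pt hvu _ _⟩,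
      Or.inr fun y hy => ?_⟩
    obtain ⟨hy, hym⟩ := (hface y).1 hy
    obtain ⟨k, hk, rfl⟩ := hbottom y hy hym
    refine ⟨W - 1 - k, ?_⟩
    rw [sub_eq_add_neg, ← neg_smul, pt_add_smul]
    congr 1
    omega
  -- A one-point bottom line would be a generated unique lowest vertex, contrary to
  -- nonexpansiveness.
  have hW2 : 2 ≤ W := by
    by_contra hcon
    have hW1 : W = 1 := by omega
    refine hne (isOneSidedExpansive_of_isGenerated hvu hS.finite (x := pt v u (a m) m)
      hleft.1.1 (hgen _ hleft) fun s hs hsx => ?_)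
    rw [cross_pt hvu]
    refine lt_of_le_of_ne (hs₀min s hs) fun e => hsx ?_
    obtain ⟨k, hk, rfl⟩ := hbottom s hs e.symm
    have : k = 0 := by omega
    simp [this]
  have hD1 : 1 ≤ D := by
    obtain ⟨s, hs, hsf⟩ := hdiff_ne
    have h1 := hs₀min s hs
    have h2 := hs₁max s hs
    have h3 : cross v s ≠ m := fun e => hsf ((hface s).2 ⟨hs, e⟩)
    omega
  refine ⟨⟨hS.finite, hS.convex, hdiff_ne, ?_, hgen, ?_⟩, m, D, W, a, hS.finite, hvu, hW2, hD1,
    hs₀min, fun s hs => by have := hs₁max s hs; omega, hbottom, hbottom_mem, ?_, hgen _ hleft,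
    hgen _ hright, ?_⟩
  · rintro t ⟨z, hz, rfl⟩
    exact hrows _ (hs₀min z hz) (by have := hs₁max z hz; omega)
  · have := hS.complexity_le
    unfold discrepancy
    omega
  · intro t h1 h2 k hk
    have := hrows t h1.le h2
    exact (ha t _).2 ⟨by omega, by omega⟩
  · have := hS.complexity_le
    omega

end Nivat

theorem proposition4p9 {A : Type*} [Finite A] (η : ℤ × ℤ → A)
    (n k : ℕ) (hP : (Nivat.complexity η (Nivat.rect n k) : ℝ) ≤ (n : ℝ) * (k : ℝ) / 2)
    (v : ℤ × ℤ) (hv : IsCoprime v.1 v.2) (hne : ¬ Nivat.IsOneSidedExpansive η v)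
    (H : Set (ℤ × ℤ)) (hH : Nivat.IsHalfPlane v H) :
    ∃ S : Set (ℤ × ℤ), Nivat.IsBalanced η v S ∧
      -- `S` has an edge parallel to `v`; its integer points are `Nivat.face v S`
      2 ≤ (Nivat.face v S).ncard ∧
      ∀ f : ℤ × ℤ → A, Nivat.IsHalfPlaneAmbiguous η v S H f →
        (∃ p : ℤ, Nivat.PeriodicOn f Set.univ (p • v)) ∧
        Nivat.HasPeriodAtMost f (Nivat.border v (S \ Nivat.face v S) H) v
          ((Nivat.face v S).ncard - 1) ∧
        ∀ B : Set (ℤ × ℤ), Nivat.IsStrip v B →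
          Nivat.diam v B = Nivat.diam v (S \ Nivat.face v S) →
          Nivat.HasPeriodAtMost f B v (2 * (Nivat.face v S).ncard - 2) := by
  obtain ⟨u, hvu⟩ := Nivat.exists_cross_eq_one hv
  by_cases hper : ∃ p : ℕ, 1 ≤ p ∧ ∀ z, η (z + (p : ℤ) • v) = η z
  · obtain ⟨p, hp1, hp⟩ := hper
    exact Nivat.exists_balanced_of_periodic hvu hp1 hp hH
  · have hP' : 2 * Nivat.complexity η (Nivat.rect n k) ≤ n * k := by
      have : (2 : ℝ) * Nivat.complexity η (Nivat.rect n k) ≤ n * k := by linarith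
      exact_mod_cast this
    obtain ⟨S, hS, hmin⟩ := (Nivat.isCandidate_halfRect η hvu hP').exists_minimal
    obtain ⟨hbal, m, D, W, a, hlay⟩ := hS.exists_isLayered hvu hne hper hmin
    exact ⟨S, hbal, hlay.ncard_face ▸ hlay.two_le,
      fun f hf => hlay.periodic_of_ambiguous hS.complexity_le hH hf⟩
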